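/- **Theorem (correctness and finiteness of the LFG algorithm).** Let $A\in\mathbb Z^{m\times n}$, $b\in\mathbb Z^m$, $C\in\mathbb Z^{l\times n}$, $d\in\mathbb Z^l$ be arbitrary integer data. Write $a_i,c_k$ for the rows of $A,C$. The LFG algorithm, described below and run in exact real arithmetic on the system $$Ax=b,\qquad Cx\le d,\qquad x\in\mathbb R^n, \tag{1}$$ is correct and finite: there is a number $B$, depending only on the input, such that for all admissible choices made during the run every execution stops after at most $B$ steps; it never gets stuck; and when it stops it has either returned a point $\hat x\in\mathbb R^n$ with $A\hat x=b$, $C\hat x\le d$, or declared infeasibility, the latter only if (1) has no solution $x\in\mathbb R^n$. (A step is one step of the descriptions below; the recursive calls of D&C are counted.) *The Elementary Procedure* EP for a system $Ax=b,\ Cx\le d$ at $(z,r)$. Let $p$ be the orthogonal projection of $z$ onto $\{y: Ay=b\}$. If $\|p-z\|<r$ and $(c_kz-d_k)/\|c_k\|<r$ for all $k$, return the solution $p$. Else, if $\|p-z\|\ge r$, return the hyperplane $hx=\delta$ with $h=z-p$, $\delta=h\cdot p$. Else choose $k$ with $(c_kz-d_k)/\|c_k\|\ge r$ and return the hyperplane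 $c_kx=d_k$. *The D&C algorithm* at $(z,r,\varepsilon)$, with $\theta=2/5$. If $r\le\varepsilon/(2\max_k\|c_k\|)$, return the result of EP at $(z,r)$. Otherwise call D&C at $(z,\frac r{1+\theta},\varepsilon)$. If it returns a solution, return that solution; if it fails, fail; if it returns $h_1x=\delta_1$, put $z_0=z-\frac{h_1z-\delta_1}{h_1\cdot h_1}h_1$ and call D&C at $(z_0,\frac r{1+\theta},\varepsilon)$. If this returns a solution, return it; if it fails, fail; if it returns $h_2x=\delta_2$, then fail if $h_1=-\gamma h_2$ for some $\gamma>0$, and otherwise choose $\alpha\in[0,1]$ such that $h=\alpha h_1+(1-\alpha)h_2$ and $\delta=\alpha\delta_1+(1-\alpha)\delta_2$ satisfy $(hz-\delta)/\|h\|\ge r$, and return $hx=\delta$. *The LFG algorithm.* Let $T$ be the bit length of the input, that is, the sum of $1+\lceil\log_2(|a|+1)\rceil$ over all entries $a$ of $A,b,C,d$, and let $\nu=2^{-2T}$. Relax (1) to $Ax=b,\ Cx\le d+\frac\nu2\mathbf 1$, homogenize it to $Ax-bt=0,\ Cx-(d+\frac\nu2\mathbf 1)t\le0,\ -t\le-1$,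 and strengthen it to $$Ax-bt=0,\qquad Cx-(d+\tfrac\nu2\mathbf 1)t\le-\mathbf 1,\qquad -t\le-2. \tag{2}$$ Run D&C once on (2) with $z=0$, $\varepsilon=1$ and $r=2^{5(n+1)^2\varphi}\sqrt{n+1}$, where $\varphi$ is the facet complexity of the solution set $P\subseteq\mathbb R^{n+1}$ of (2): the least integer $\varphi\ge n+1$ such that $P$ is defined by a finite system of rational linear inequalities each of size at most $\varphi$. Here a rational $p/q$ in lowest terms has size $1+\lceil\log_2(|p|+1)\rceil+\lceil\log_2(|q|+1)\rceil$, a vector has size its number of entries plus the sum of the sizes of its entries, and $ax\le\beta$ has size $1+\mathrm{size}(a)+\mathrm{size}(\beta)$. If D&C fails or returns a hyperplane, declare infeasibility. If D&C returns $(x^*,t^*)$, start from $x=x^*/t^*$ and round as follows. *Rounding.* Let $L_x=\{k: d_k\le c_kx<d_k+\nu\}$. While some $c_k$ with $k\notin L_x$ is not in the linear span of all $a_i$ and of the $c_j$, $j\in L_x$, choose such a $k$ and a vector $w$ with $Aw=0$, $c_jw=0$ for $j\in L_x$, and $c_kw=1$, and replace $x$ by $x+\lambda w$, where $\lambda=\min\{(d_j-c_jx)/(c_jw):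 j\notin L_x,\ c_jw>0\}$. When there is no such $k$, choose a set $I'$ of rows of $A$ and a set $L'\subseteq L_x$ such that $\{a_i\}_{i\in I'}$ spans the row space of $A$ and $\{a_i\}_{i\in I'}\cup\{c_j\}_{j\in L'}$ is a linearly independent family with the same span as all the $a_i$ together with the $c_j$, $j\in L_x$; return any $\hat x$ with $a_i\hat x=b_i$ ($i\in I'$) and $c_j\hat x=d_j$ ($j\in L'$). -/

import Mathlib

open scoped Matrix

noncomputable section

namespace LFG

/-! ## Linear systems `A x = b`, `C x ≤ d` -/

/-- A real linear system `A x = b`, `C x ≤ d`; equations are indexed by `I`, inequalities by `K`,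
variables by `J`. -/
structure LinSys (I K J : Type) where
  A : Matrix I J ℝ
  b : I → ℝ
  C : Matrix K J ℝ
  d : K → ℝ

namespace LinSys

variable {I K J : Type}

/-- `x` solves `A x = b`, `C x ≤ d`. -/
def Feasible [Fintype J] (S : LinSys I K J) (x : J → ℝ) : Prop :=
  S.A *ᵥ x = S.b ∧ ∀ k, (S.C *ᵥ x) k ≤ S.d k

/-- The relaxed system `A x = b`, `C x ≤ d + η 1`. -/
def relax (S : LinSys I K J) (η : ℝ) : LinSys I K J where
  A := S.A
  b := S.b
  C := S.C
  d := fun k => S.d k + η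

/-- The parameterized (homogenized) system in the variables `(x, t)`:
`A x - b t = 0`, `C x - d t ≤ 0`, `-t ≤ -1`. -/
def parameterize (S : LinSys I K J) : LinSys I (K ⊕ Unit) (J ⊕ Unit) where
  A := Matrix.fromCols S.A (Matrix.of fun i _ => -S.b i)
  b := 0
  C := Matrix.fromBlocks S.C (Matrix.of fun k _ => -S.d k) 0 (Matrix.of fun _ _ => -1)
  d := Sum.elim (fun _ => 0) (fun _ => -1)

/-- The strengthened system `A x = b`, `C x ≤ d - ε 1`. -/
def strengthen (S : LinSys I K J) (ε : ℝ) : LinSys I K J where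
  A := S.A
  b := S.b
  C := S.C
  d := fun k => S.d k - ε

/-- The `k`-th row `c_k` of `C` as a Euclidean vector. -/
def row (S : LinSys I K J) (k : K) : EuclideanSpace ℝ J := WithLp.toLp 2 (S.C k)

/-- `‖c_max‖`, the largest Euclidean norm of a row of `C`. -/
def normCmax [Fintype J] (S : LinSys I K J) : ℝ := ⨆ k, ‖S.row k‖

/-- `p` is the orthogonal projection of `z` onto the affine subspace `{y | A y = b}`. -/
def IsProj [Fintype J] (S : LinSys I K J) (z p : EuclideanSpace ℝ J) : Prop :=
  S.A *ᵥ p.ofLp = S.b ∧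
    ∀ y : EuclideanSpace ℝ J, S.A *ᵥ y.ofLp = S.b → inner ℝ (z - p) (y - p) = 0

end LinSys

/-! ## The Elementary Procedure and the divide-and-conquer (D&C) algorithm -/

/-- Possible outcomes of D&C: an approximate solution, a hyperplane `h x = δ`, or failure. -/
inductive Outcome (E : Type) where
  | solution (x : E)
  | hyperplane (h : E) (δ : ℝ)
  | failure

section DC

variable {I K J : Type} [Fintype J]

/-- `EP S z r o`: the Elementary Procedure on the system `S`, with center `z` and radius `r`, can
return `o` (the violated inequality reported in the last case may be any of them). -/
inductive EP (S : LinSys I K J) (z : EuclideanSpace ℝ J) (r : ℝ) :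
    Outcome (EuclideanSpace ℝ J) → Prop where
  | solution (p : EuclideanSpace ℝ J) (hp : S.IsProj z p) (h₁ : ‖p - z‖ < r)
      (h₂ : ∀ k, ((S.C *ᵥ z.ofLp) k - S.d k) / ‖S.row k‖ < r) : EP S z r (.solution p)
  | affine (p : EuclideanSpace ℝ J) (hp : S.IsProj z p) (h₁ : r ≤ ‖p - z‖) :
      EP S z r (.hyperplane (z - p) (inner ℝ (z - p) p))
  | violated (p : EuclideanSpace ℝ J) (hp : S.IsProj z p) (h₁ : ‖p - z‖ < r) (k : K)
      (h₂ : r ≤ ((S.C *ᵥ z.ofLp) k - S.d k) / ‖S.row k‖) :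
      EP S z r (.hyperplane (S.row k) (S.d k))

/-- The parameter of the recursion: radii shrink by the factor `1 / (1 + θ) = 5 / 7`. -/
def theta : ℝ := 2 / 5

/-- A pending call of D&C with parameters `z, r`: it waits for the result of its first recursive
call, or for that of its second one, the first having returned `h₁ x = δ₁`. -/
inductive Frame (E : Type) where
  | first (z : E) (r : ℝ)
  | second (z : E) (r : ℝ) (h₁ : E) (δ₁ : ℝ)

/-- A configuration of a run of D&C: about to execute a call with parameters `z, r`, or about to
return an outcome, in both cases to the pending calls on the stack. -/
inductive DCState (E : Type) where
  | call (z : E) (r : ℝ) (stack : List (Frame E))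
  | ret (o : Outcome E) (stack : List (Frame E))

/-- The orthogonal projection of `z` onto the hyperplane `h x = δ`. -/
def projHyperplane (h : EuclideanSpace ℝ J) (δ : ℝ) (z : EuclideanSpace ℝ J) :
    EuclideanSpace ℝ J :=
  z - ((inner ℝ h z - δ) / inner ℝ h h) • h

/-- One step of the D&C algorithm on the system `S` with error bound `ε`. -/
inductive DCStep (S : LinSys I K J) (ε : ℝ) :
    DCState (EuclideanSpace ℝ J) → DCState (EuclideanSpace ℝ J) → Prop where
  /-- The radius is small: run the Elementary Procedure and return its result. -/
  | base (z r K o) (hr : r ≤ ε / (2 * S.normCmax)) (ho : EP S z r o) :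
      DCStep S ε (.call z r K) (.ret o K)
  /-- The radius is not small: first recursive call, with the same center. -/
  | recurse (z r K) (hr : ¬ r ≤ ε / (2 * S.normCmax)) :
      DCStep S ε (.call z r K) (.call z (r / (1 + theta)) (.first z r :: K))
  /-- A recursive call found a solution: return it. -/
  | found (x F K) : DCStep S ε (.ret (.solution x) (F :: K)) (.ret (.solution x) K)
  /-- A recursive call failed: the whole run fails. -/
  | failed (F K) : DCStep S ε (.ret .failure (F :: K)) (.ret .failure K)
  /-- The first recursive call returned `h₁ x = δ₁`: second recursive call, centered at the
  projection of `z` onto that hyperplane. -/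
  | project (z r h₁ δ₁ K) :
      DCStep S ε (.ret (.hyperplane h₁ δ₁) (.first z r :: K))
        (.call (projHyperplane h₁ δ₁ z) (r / (1 + theta)) (.second z r h₁ δ₁ :: K))
  /-- The second recursive call returned `h₂ x = δ₂` with `h₁ = -γ h₂`, `γ > 0`: fail. -/
  | opposite (z r h₁ δ₁ h₂ δ₂ K) (hop : ∃ γ : ℝ, 0 < γ ∧ h₁ = -(γ • h₂)) :
      DCStep S ε (.ret (.hyperplane h₂ δ₂) (.second z r h₁ δ₁ :: K)) (.ret .failure K)
  /-- Otherwise return any convex combination of the two hyperplanes that is at distance at least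
  `r` from `z`. (For `r > 0` the last condition forces the combination to have a nonzero normal
  vector.) -/
  | combine (z r h₁ δ₁ h₂ δ₂ K) (α : ℝ) (hop : ¬ ∃ γ : ℝ, 0 < γ ∧ h₁ = -(γ • h₂))
      (hα₀ : 0 ≤ α) (hα₁ : α ≤ 1)
      (hα : r ≤ (inner ℝ (α • h₁ + (1 - α) • h₂) z - (α * δ₁ + (1 - α) * δ₂)) /
        ‖α • h₁ + (1 - α) • h₂‖) :
      DCStep S ε (.ret (.hyperplane h₂ δ₂) (.second z r h₁ δ₁ :: K))
        (.ret (.hyperplane (α • h₁ + (1 - α) • h₂) (α * δ₁ + (1 - α) * δ₂)) K)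

end DC

/-! ## Sizes, facet complexity and the radius -/

/-- The size of a rational number `p / q` (in lowest terms):
`1 + ⌈log₂ (|p| + 1)⌉ + ⌈log₂ (q + 1)⌉`. -/
def ratSize (q : ℚ) : ℕ := 1 + Nat.clog 2 (q.num.natAbs + 1) + Nat.clog 2 (q.den + 1)

/-- The size of the inequality `a x ≤ β`: `1 + size a + size β`, where the size of a vector is the
number of its entries plus the sum of their sizes. -/
def ineqSize {J : Type} [Fintype J] (a : J → ℚ) (β : ℚ) : ℕ :=
  1 + (Fintype.card J + ∑ j, ratSize (a j)) + ratSize β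

/-- The facet complexity of a rational polyhedron `P`: the least `φ`, at least the dimension of the
space, such that `P` is the solution set of a finite system of rational linear inequalities each of
size at most `φ`. -/
def facetComplexity {J : Type} [Fintype J] (P : Set (J → ℝ)) : ℕ :=
  sInf {φ : ℕ | Fintype.card J ≤ φ ∧ ∃ (N : ℕ) (M : Matrix (Fin N) J ℚ) (β : Fin N → ℚ),
    P = {x | ∀ i, ∑ j, (M i j : ℝ) * x j ≤ (β i : ℝ)} ∧ ∀ i, ineqSize (M i) (β i) ≤ φ}

/-- Schrijver's radius `2 ^ (5 N² φ) √N`, where `N` is the dimension and `φ` the facet complexity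
of the polyhedron `P`. -/
def schrijverRadius {J : Type} [Fintype J] (P : Set (J → ℝ)) : ℝ :=
  2 ^ (5 * Fintype.card J ^ 2 * facetComplexity P) * Real.sqrt (Fintype.card J)

/-! ## The LFG algorithm -/

/-- Integer input data `A, b, C, d` with `m` equations, `l` inequalities and `n` variables. -/
structure Input (m l n : ℕ) where
  A : Matrix (Fin m) (Fin n) ℤ
  b : Fin m → ℤ
  C : Matrix (Fin l) (Fin n) ℤ
  d : Fin l → ℤ

/-- The number of bits of an integer: a sign bit and `⌈log₂ (|a| + 1)⌉` binary digits. -/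
def intBits (a : ℤ) : ℕ := 1 + Nat.clog 2 (a.natAbs + 1)

namespace Input

variable {m l n : ℕ}

/-- The system `A x = b`, `C x ≤ d` over the reals. -/
def toSys (D : Input m l n) : LinSys (Fin m) (Fin l) (Fin n) where
  A := D.A.map (fun a : ℤ => (a : ℝ))
  b := fun i => (D.b i : ℝ)
  C := D.C.map (fun a : ℤ => (a : ℝ))
  d := fun k => (D.d k : ℝ)

/-- The bit length `T` of the input data. -/
def bitLength (D : Input m l n) : ℕ :=
  (∑ i, ∑ j, intBits (D.A i j)) + (∑ i, intBits (D.b i)) +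
    (∑ k, ∑ j, intBits (D.C k j)) + ∑ k, intBits (D.d k)

/-- `ν = 2 ^ (-2T)`. -/
def nu (D : Input m l n) : ℝ := ((2 : ℝ) ^ (2 * D.bitLength))⁻¹

/-- The system handed to D&C, in the variables `(x, t)`: `A x - b t = 0`,
`C x - (d + ν/2) t ≤ -1`, `-t ≤ -2`. -/
def dcSys (D : Input m l n) : LinSys (Fin m) (Fin l ⊕ Unit) (Fin n ⊕ Unit) :=
  ((D.toSys.relax (D.nu / 2)).parameterize).strengthen 1

/-- The radius handed to D&C. -/
def radius (D : Input m l n) : ℝ := schrijverRadius {y | D.dcSys.Feasible y}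

/-- `L_x`, the indices `k` with `d_k ≤ c_k x < d_k + ν`. -/
def active (D : Input m l n) (x : Fin n → ℝ) : Set (Fin l) :=
  {k | D.toSys.d k ≤ (D.toSys.C *ᵥ x) k ∧ (D.toSys.C *ᵥ x) k < D.toSys.d k + D.nu}

/-- The linear span of the rows `a_i`, `i ∈ I'`, and `c_k`, `k ∈ L'`. -/
def rowSpan (D : Input m l n) (I' : Set (Fin m)) (L' : Set (Fin l)) : Submodule ℝ (Fin n → ℝ) :=
  Submodule.span ℝ (D.toSys.A '' I' ∪ D.toSys.C '' L')

end Input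

/-- A configuration of a run of the LFG algorithm. -/
inductive State (n : ℕ) where
  | start
  | dc (s : DCState (EuclideanSpace ℝ (Fin n ⊕ Unit)))
  | rounding (x : Fin n → ℝ)
  | feasible (x : Fin n → ℝ)
  | infeasible

/-- One step of the LFG algorithm on the input `D`. -/
inductive Step {m l n : ℕ} (D : Input m l n) : State n → State n → Prop where
  /-- Set up the strengthened parameterized system and call D&C with `z = 0` and the radius. -/
  | init : Step D .start (.dc (.call 0 D.radius []))
  /-- One step of D&C, with `ε = 1`. -/
  | dc (s s') (hs : DCStep D.dcSys 1 s s') : Step D (.dc s) (.dc s')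
  /-- D&C found `(x, t)`: round `x / t` to an exact solution. -/
  | found (y : EuclideanSpace ℝ (Fin n ⊕ Unit)) :
      Step D (.dc (.ret (.solution y) []))
        (.rounding fun j => y.ofLp (.inl j) / y.ofLp (.inr ()))
  /-- D&C returned a hyperplane: declare infeasibility. -/
  | separated (h δ) : Step D (.dc (.ret (.hyperplane h δ) [])) .infeasible
  /-- D&C failed: declare infeasibility. -/
  | failed : Step D (.dc (.ret .failure [])) .infeasible
  /-- Rounding, main loop. Some `c_k`, `k ∉ L_x`, is not a linear combination of the `a_i` and of
  the `c_j`, `j ∈ L_x`: take a direction `w` with `a_i w = 0`, `c_j w = 0` for `j ∈ L_x` and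
  `c_k w = 1`, and move along `w` until the first inequality outside `L_x` becomes tight. -/
  | move (x w : Fin n → ℝ) (k j : Fin l)
      (hk : k ∉ D.active x) (hspan : D.toSys.C k ∉ D.rowSpan Set.univ (D.active x))
      (hwA : D.toSys.A *ᵥ w = 0) (hwL : ∀ i ∈ D.active x, (D.toSys.C *ᵥ w) i = 0)
      (hwk : (D.toSys.C *ᵥ w) k = 1)
      (hj : j ∉ D.active x) (hwj : 0 < (D.toSys.C *ᵥ w) j)
      (hmin : ∀ i, i ∉ D.active x → 0 < (D.toSys.C *ᵥ w) i →
        (D.toSys.d j - (D.toSys.C *ᵥ x) j) / (D.toSys.C *ᵥ w) j ≤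
          (D.toSys.d i - (D.toSys.C *ᵥ x) i) / (D.toSys.C *ᵥ w) i) :
      Step D (.rounding x)
        (.rounding (x + ((D.toSys.d j - (D.toSys.C *ᵥ x) j) / (D.toSys.C *ᵥ w) j) • w))
  /-- Rounding, exit. Every `c_k` is a linear combination of the `a_i` and of the `c_j`, `j ∈ L_x`:
  take a maximal linearly independent family consisting of rows `a_i`, `i ∈ I'`, that span all rows
  of `A`, and of rows `c_j`, `j ∈ L' ⊆ L_x`, and return a solution `y` of the equations
  `a_i y = b_i` (`i ∈ I'`), `c_j y = d_j` (`j ∈ L'`). -/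
  | finish (x y : Fin n → ℝ) (I' : Set (Fin m)) (L' : Set (Fin l))
      (hspan : ∀ k, k ∉ D.active x → D.toSys.C k ∈ D.rowSpan Set.univ (D.active x))
      (hL : L' ⊆ D.active x)
      (hindep : LinearIndependent ℝ
        (Sum.elim (fun i : I' => D.toSys.A i) (fun k : L' => D.toSys.C k)))
      (hI : D.rowSpan I' ∅ = D.rowSpan Set.univ ∅)
      (hmax : D.rowSpan I' L' = D.rowSpan Set.univ (D.active x))
      (hyA : ∀ i ∈ I', (D.toSys.A *ᵥ y) i = D.toSys.b i)
      (hyL : ∀ k ∈ L', (D.toSys.C *ᵥ y) k = D.toSys.d k) :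
      Step D (.rounding x) (.feasible y)

/-- `StepsTo D N s`: some execution of the LFG algorithm on `D` is in configuration `s` after
exactly `N` steps. -/
inductive StepsTo {m l n : ℕ} (D : Input m l n) : ℕ → State n → Prop where
  | zero : StepsTo D 0 .start
  | succ (N s s') (h : StepsTo D N s) (hs : Step D s s') : StepsTo D (N + 1) s'

end LFG

end

namespace LFG

/-! ## Integer linear algebra -/

section LinearAlgebra

/-! A run is controlled by an invariant `Inv` and a natural number `cost` that drops at every step.
`StepsTo.inv` carries both along, so the initial cost bounds every run, whatever the choices. By
`Inv.progress` only final configurations are stuck, and there `Inv` is the claimed correctness of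
the output.

D&C: `OutcomeOK` says that a call at `(z, r)` yields an approximate solution, a valid inequality
violated at `z` by distance at least `r`, or an infeasibility proof. The crux is
`exists_combination`. If `z` violates the first inequality by `ρ` and its projection onto the first
hyperplane violates the second by `ρ`, then the intersection of the two half-spaces is at distance
at least `√2 ρ > (7/5) ρ` from `z`, and a convex combination of the inequalities shows it. Radii
shrink by `5/7`, so the recursion has bounded depth.

Infeasibility: a solution `x` of the input gives the solution `(2/ν)(x, 1)` of the strengthened
system. A nonempty rational polyhedron has a point of norm below the radius
(`IsRationalPolyhedron.exists_norm_lt`, from Cramer's rule at a point with enough tight rows), which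
a hyperplane returned at the origin would cut off.

Rounding: each move enlarges `L_x`, so there are at most `l` moves. At the exit each `c_k` is a
combination of the selected rows with coefficients `μ_s / Δ`, where `|Δ| + ∑ |μ_s| ≤ 2^(2T) = 1/ν`.
Hence `|Δ| (c_k y - d_k)` is an integer smaller than 1, so it is not positive
(`Input.IsApprox.feasible_of_finish`). -/

/-- A determinant is bounded by the product of the `ℓ¹` norms of the rows. -/
theorem abs_det_le_prod_sum {ι : Type*} [Fintype ι] [DecidableEq ι] (M : Matrix ι ι ℤ) :
    |M.det| ≤ ∏ i, ∑ j, |M i j| := by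
  classical
  rw [← Matrix.det_transpose, Matrix.det_apply, Finset.prod_univ_sum]
  refine (Finset.abs_sum_le_sum_abs _ _).trans ?_
  have h : ∀ σ : Equiv.Perm ι, |Equiv.Perm.sign σ • ∏ i, Mᵀ (σ i) i| = ∏ i, |M i (σ i)| := by
    intro σ
    rcases Int.units_eq_one_or (Equiv.Perm.sign σ) with h | h <;>
      simp [h, Finset.abs_prod, Units.smul_def]
  simp_rw [h]
  -- The product of row sums expands into a sum over all maps `ι → ι`; the Leibniz terms are those
  -- of the permutations.
  rw [← Finset.sum_image (s := Finset.univ) (g := fun σ : Equiv.Perm ι => (σ : ι → ι))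
    (f := fun f => ∏ i, |M i (f i)|) (fun _ _ _ _ h => DFunLike.coe_injective h)]
  refine Finset.sum_le_sum_of_subset_of_nonneg ?_ fun f _ _ =>
    Finset.prod_nonneg fun i _ => abs_nonneg _
  intro f _
  simp

/-- A linearly independent family of rows has a nonsingular square submatrix with the same rows. -/
theorem exists_submatrix_det_ne_zero {ι J : Type} [Fintype ι] [DecidableEq ι] [Fintype J]
    (M : Matrix ι J ℝ) (hM : LinearIndependent ℝ M) :
    ∃ e : ι → J, Function.Injective e ∧ (M.submatrix id e).det ≠ 0 := by
  classical
  -- Row rank equals column rank, so a maximal independent set of columns has as many members as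
  -- there are rows.
  obtain ⟨κ, a, ha, hspan, hli⟩ := exists_linearIndependent' ℝ M.col
  have : Finite κ := Finite.of_injective a ha
  have := Fintype.ofFinite κ
  have hcard : Fintype.card κ = Fintype.card ι := by
    rw [linearIndependent_iff_card_eq_finrank_span.mp hli, Set.finrank, hspan,
      ← Matrix.rank_eq_finrank_span_cols, LinearIndependent.rank_matrix hM]
  let g : ι ≃ κ := Fintype.equivOfCardEq hcard.symm
  refine ⟨a ∘ g, ha.comp g.injective, ?_⟩
  have h : LinearIndependent ℝ (M.submatrix id (a ∘ g)).col := hli.comp g g.injective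
  rw [Matrix.linearIndependent_cols_iff_isUnit] at h
  exact ((Matrix.isUnit_iff_isUnit_det _).mp h).ne_zero

/-- Integer Cramer rule for a linearly independent family of integer rows: there are a common
denominator `Δ` for the coefficients of all integer vectors in the real span of the family, and a
small solution of every integer system with these rows. -/
theorem exists_cramer {ι J : Type} [Fintype ι] [Fintype J] (v : ι → J → ℤ)
    (hv : LinearIndependent ℝ fun i j => (v i j : ℝ)) :
    ∃ Δ : ℤ, Δ ≠ 0 ∧ |Δ| ≤ ∏ i, (1 + ∑ j, |v i j|) ∧
      (∀ (u : J → ℤ) (c : ι → ℝ), (∀ j, (u j : ℝ) = ∑ i, c i * v i j) →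
        ∃ μ : ι → ℤ, (∀ i, Δ * c i = μ i) ∧
          ∀ i, |μ i| ≤ (1 + ∑ j, |u j|) * ∏ i, (1 + ∑ j, |v i j|)) ∧
      ∀ β : ι → ℤ, ∃ y : J → ℝ, (∀ i, ∑ j, (v i j : ℝ) * y j = β i) ∧
        ∀ j, |y j| ≤ ∏ i, ((∑ j, |v i j|) + |β i| : ℤ) := by
  classical
  obtain ⟨e, he, hdet⟩ := exists_submatrix_det_ne_zero (Matrix.of fun i j => (v i j : ℝ)) hv
  set M : Matrix ι ι ℤ := Matrix.of fun i k => v i (e k) with hMdef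
  have hMcast : (M.map (Int.castRingHom ℝ)) =
      (Matrix.of fun i j => (v i j : ℝ)).submatrix id e := by
    ext i k; simp [hMdef]
  have hdetcast : ((M.det : ℤ) : ℝ) = ((Matrix.of fun i j => (v i j : ℝ)).submatrix id e).det := by
    rw [← hMcast]; exact (RingHom.map_det (Int.castRingHom ℝ) M)
  have hΔR : ((M.det : ℤ) : ℝ) ≠ 0 := by rwa [hdetcast]
  have hΔ : M.det ≠ 0 := by exact_mod_cast hΔR
  have hsub : ∀ u : J → ℤ, ∑ k, |u (e k)| ≤ ∑ j, |u j| := fun u => by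
    rw [← Finset.sum_image (s := Finset.univ) (f := fun j => |u j|) (fun _ _ _ _ h => he h)]
    exact Finset.sum_le_sum_of_subset_of_nonneg (Finset.subset_univ _) fun _ _ _ => abs_nonneg _
  have hnn : ∀ u : J → ℤ, 0 ≤ ∑ j, |u j| := fun u => Finset.sum_nonneg fun _ _ => abs_nonneg _
  have hinj : ∀ x : ι → ℝ, (∀ k, ∑ i, x i * M i k = 0) → x = 0 := by
    intro x hx
    refine Matrix.eq_zero_of_vecMul_eq_zero hdet ?_
    ext k
    rw [← hMcast]
    simpa [Matrix.vecMul, dotProduct] using hx k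
  refine ⟨M.det, hΔ, ?_, ?_, ?_⟩
  · refine (abs_det_le_prod_sum M).trans (Finset.prod_le_prod
      (fun i _ => Finset.sum_nonneg fun _ _ => abs_nonneg _) fun i _ => ?_)
    have := hsub (v i)
    simp only [hMdef, Matrix.of_apply]
    linarith
  · intro u c hu
    refine ⟨Matrix.cramer Mᵀ fun k => u (e k), ?_, ?_⟩
    · have hcr := Matrix.mulVec_cramer Mᵀ fun k => u (e k)
      have h0 := hinj (fun i => M.det * c i - Matrix.cramer Mᵀ (fun k => u (e k)) i) fun k => by
        have h1 := congrFun hcr k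
        simp only [Matrix.mulVec, dotProduct, Matrix.transpose_apply, Matrix.det_transpose,
          Pi.smul_apply, smul_eq_mul] at h1
        have h2 : (∑ i, (M i k : ℝ) * (Matrix.cramer Mᵀ (fun k => u (e k)) i : ℤ)) =
            M.det * u (e k) := by exact_mod_cast h1
        have h3 := hu (e k)
        simp only [sub_mul, Finset.sum_sub_distrib]
        rw [Finset.sum_congr rfl fun i _ => mul_comm ((Matrix.cramer Mᵀ _ i : ℤ) : ℝ) (M i k : ℝ),
          h2, h3, Finset.mul_sum]
        simp [hMdef, mul_assoc]
      intro i
      have := congrFun h0 i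
      simp only [Pi.zero_apply] at this
      linarith
    · intro i
      rw [Matrix.cramer_transpose_apply]
      refine (abs_det_le_prod_sum _).trans ?_
      rw [← Finset.mul_prod_erase _ _ (Finset.mem_univ i)]
      refine mul_le_mul ?_ ?_ (Finset.prod_nonneg fun i _ => Finset.sum_nonneg fun _ _ =>
        abs_nonneg _) (by have := hnn u; linarith)
      · have := hsub u
        simp only [Matrix.updateRow_self]
        linarith
      · calc _ ≤ ∏ i' ∈ Finset.univ.erase i, (1 + ∑ j, |v i' j|) := by
              refine Finset.prod_le_prod (fun i _ => Finset.sum_nonneg fun _ _ => abs_nonneg _) ?_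
              intro i' hi'
              have := hsub (v i')
              simp only [Matrix.updateRow_ne (Finset.ne_of_mem_erase hi'), hMdef, Matrix.of_apply]
              linarith
          -- The factor of the replaced row is at least 1; restoring it makes the bound uniform in
          -- `i`.
          _ ≤ (1 + ∑ j, |v i j|) * ∏ i' ∈ Finset.univ.erase i, (1 + ∑ j, |v i' j|) := by
              refine le_mul_of_one_le_left ?_ (by have := hnn (v i); linarith)
              exact Finset.prod_nonneg fun i' _ => by have := hnn (v i'); linarith
          _ = _ := Finset.mul_prod_erase _ (fun i' => 1 + ∑ j, |v i' j|) (Finset.mem_univ i)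
  · intro β
    -- The basic solution: Cramer's values on the columns chosen by `e`, zero elsewhere. Dividing by
    -- the integer `M.det ≠ 0` does not increase absolute values.
    refine ⟨fun j => ∑ k, if e k = j then (Matrix.cramer M β k : ℝ) / M.det else 0, ?_, ?_⟩
    · intro i
      have h1 := congrFun (Matrix.mulVec_cramer M β) i
      simp only [Matrix.mulVec, dotProduct, Pi.smul_apply, smul_eq_mul] at h1
      have h2 : (∑ k, (M i k : ℝ) * (Matrix.cramer M β k : ℤ)) = M.det * β i := by
        exact_mod_cast h1
      simp only [Finset.mul_sum]
      rw [Finset.sum_comm]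
      have h3 : ∀ k, ∑ j, (v i j : ℝ) * (if e k = j then (Matrix.cramer M β k : ℝ) / M.det else 0)
          = (M i k * (Matrix.cramer M β k : ℤ)) / M.det := fun k => by
        simp [hMdef, mul_div_assoc]
      simp_rw [h3]
      rw [← Finset.sum_div, h2]
      field_simp
    · intro j
      have hB : ∀ k, |(Matrix.cramer M β k : ℝ) / M.det| ≤
          ∏ i, ((∑ j, |v i j|) + |β i| : ℤ) := by
        intro k
        have h1 : |Matrix.cramer M β k| ≤ ∏ i, ((∑ j, |v i j|) + |β i|) := by
          rw [Matrix.cramer_apply]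
          refine (abs_det_le_prod_sum _).trans (Finset.prod_le_prod
            (fun i _ => Finset.sum_nonneg fun _ _ => abs_nonneg _) fun i _ => ?_)
          rw [← Finset.add_sum_erase _ _ (Finset.mem_univ k), Matrix.updateCol_self, add_comm]
          gcongr
          refine le_trans ?_ (hsub (v i))
          rw [Finset.sum_congr rfl fun j hj => by
            rw [Matrix.updateCol_ne (Finset.ne_of_mem_erase hj)]]
          exact Finset.sum_le_sum_of_subset_of_nonneg (Finset.subset_univ _)
            fun _ _ _ => abs_nonneg _
        rw [abs_div]
        refine (div_le_self (abs_nonneg _) ?_).trans (by exact_mod_cast h1)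
        exact_mod_cast Int.one_le_abs hΔ
      by_cases hj : ∃ k, e k = j
      · obtain ⟨k, rfl⟩ := hj
        simpa [he.eq_iff] using hB k
      · push Not at hj
        have : (0 : ℤ) ≤ ∏ i, ((∑ j, |v i j|) + |β i|) :=
          Finset.prod_nonneg fun i _ => add_nonneg (hnn _) (abs_nonneg _)
        simp only [hj, if_false, Finset.sum_const_zero, abs_zero]
        exact_mod_cast this

/-- A vector outside the span of `s` is separated from it by a linear functional. -/
theorem exists_dotProduct_eq_one {J : Type} [Fintype J] (s : Set (J → ℝ)) (u : J → ℝ)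
    (hu : u ∉ Submodule.span ℝ s) : ∃ w : J → ℝ, (∀ a ∈ s, a ⬝ᵥ w = 0) ∧ u ⬝ᵥ w = 1 := by
  classical
  obtain ⟨f, hfu, hf⟩ := Submodule.exists_le_ker_of_notMem hu
  have hrep : ∀ a : J → ℝ, a ⬝ᵥ (fun j => f (Pi.single j 1)) = f a := fun a => by
    conv_rhs => rw [← Finset.univ_sum_single a, map_sum]
    refine Finset.sum_congr rfl fun j _ => ?_
    rw [← smul_eq_mul, ← map_smul, ← Pi.single_smul', smul_eq_mul, mul_one]
  refine ⟨(f u)⁻¹ • fun j => f (Pi.single j 1), fun a ha => ?_, ?_⟩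
  · rw [dotProduct_smul, hrep, LinearMap.mem_ker.mp (hf (Submodule.subset_span ha)), smul_zero]
  · rw [dotProduct_smul, hrep, smul_eq_mul, inv_mul_cancel₀ hfu]

/-- This lets one point be exchanged for another that agrees with it only on spanning rows; used for
small points and for rounding. -/
theorem dotProduct_eq_of_mem_span {J : Type} [Fintype J] {s : Set (J → ℝ)} {x y u : J → ℝ}
    (hs : ∀ a ∈ s, a ⬝ᵥ x = a ⬝ᵥ y) (hu : u ∈ Submodule.span ℝ s) : u ⬝ᵥ x = u ⬝ᵥ y := by
  induction hu using Submodule.span_induction with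
  | mem u hu => exact hs u hu
  | zero => simp
  | add u v _ _ hu hv => rw [add_dotProduct, add_dotProduct, hu, hv]
  | smul a u _ hu => rw [smul_dotProduct, smul_dotProduct, hu]

/-- A nonempty polyhedron has a point at which the tight rows span all rows. -/
theorem exists_tight_span {ι J : Type} [Finite ι] [Fintype J] (M : ι → J → ℝ) (β : ι → ℝ)
    (hP : ∃ x, ∀ i, M i ⬝ᵥ x ≤ β i) :
    ∃ x, (∀ i, M i ⬝ᵥ x ≤ β i) ∧ ∀ k, M k ∈ Submodule.span ℝ (M '' {i | M i ⬝ᵥ x = β i}) := by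
  classical
  -- Take a feasible point with the most tight rows. If a row were outside their span, moving along
  -- a direction orthogonal to the tight rows would make a further one tight.
  obtain ⟨x, hx, hmax⟩ : ∃ x, (∀ i, M i ⬝ᵥ x ≤ β i) ∧ ∀ y, (∀ i, M i ⬝ᵥ y ≤ β i) →
      ({i | M i ⬝ᵥ y = β i} : Set ι).ncard ≤ ({i | M i ⬝ᵥ x = β i} : Set ι).ncard := by
    have hbdd : BddAbove ((fun y => ({i | M i ⬝ᵥ y = β i} : Set ι).ncard) ''
        {y | ∀ i, M i ⬝ᵥ y ≤ β i}) :=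
      ⟨Nat.card ι, by rintro _ ⟨y, -, rfl⟩; exact Set.ncard_le_card _⟩
    obtain ⟨x, hx, hxe⟩ := Nat.sSup_mem ((show ({y | ∀ i, M i ⬝ᵥ y ≤ β i}).Nonempty from hP).image
      (fun y => ({i | M i ⬝ᵥ y = β i} : Set ι).ncard)) hbdd
    refine ⟨x, hx, fun y hy => ?_⟩
    have := le_csSup hbdd ⟨y, hy, rfl⟩
    simp only at hxe this ⊢
    rwa [hxe]
  refine ⟨x, hx, fun k => ?_⟩
  by_contra hk
  obtain ⟨w, hw0, hwk⟩ := exists_dotProduct_eq_one _ _ hk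
  have htight : ∀ i, 0 < M i ⬝ᵥ w → M i ⬝ᵥ x ≠ β i := fun i hi hti => by
    rw [hw0 _ ⟨i, hti, rfl⟩] at hi; exact lt_irrefl _ hi
  obtain ⟨j, hj, hmin⟩ := Set.exists_min_image {i | 0 < M i ⬝ᵥ w}
    (fun i => (β i - M i ⬝ᵥ x) / (M i ⬝ᵥ w)) (Set.toFinite _) ⟨k, by simp [hwk]⟩
  simp only [Set.mem_ofPred_eq] at hj hmin
  set t := (β j - M j ⬝ᵥ x) / (M j ⬝ᵥ w) with ht
  have ht0 : 0 ≤ t := div_nonneg (by linarith [hx j]) hj.le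
  have hy : ∀ i, M i ⬝ᵥ (x + t • w) = M i ⬝ᵥ x + t * (M i ⬝ᵥ w) := fun i => by
    rw [dotProduct_add, dotProduct_smul, smul_eq_mul]
  have hfeas : ∀ i, M i ⬝ᵥ (x + t • w) ≤ β i := fun i => by
    rw [hy]
    rcases lt_or_ge 0 (M i ⬝ᵥ w) with hi | hi
    · have := (le_div_iff₀ hi).mp (hmin i hi)
      linarith
    · nlinarith [hx i]
  have hss : {i | M i ⬝ᵥ x = β i} ⊂ {i | M i ⬝ᵥ (x + t • w) = β i} := by
    rw [Set.ssubset_iff_of_subset]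
    · refine ⟨j, ?_, htight j hj⟩
      rw [Set.mem_ofPred_eq, hy, ht, div_mul_cancel₀ _ hj.ne']
      ring
    · intro i hi
      rw [Set.mem_ofPred_eq, hy, hw0 _ ⟨i, hi, rfl⟩, mul_zero, add_zero]
      exact hi
  exact absurd (hmax _ hfeas) (not_le.mpr (Set.ncard_lt_ncard hss (Set.toFinite _)))

end LinearAlgebra

end LFG

namespace LFG

/-! ## Correctness and finiteness of D&C -/

section DC

variable {I K J : Type} [Fintype J]

theorem inner_row (S : LinSys I K J) (k : K) (x : EuclideanSpace ℝ J) :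
    inner ℝ (S.row k) x = (S.C *ᵥ x.ofLp) k := by
  simp [LinSys.row, EuclideanSpace.inner_eq_star_dotProduct, Matrix.mulVec, dotProduct_comm]

/-- The orthogonal projection onto a nonempty solution set `{y | A y = b}` exists. -/
theorem LinSys.exists_isProj (S : LinSys I K J) (hS : ∃ x, S.A *ᵥ x = S.b)
    (z : EuclideanSpace ℝ J) : ∃ p, S.IsProj z p := by
  obtain ⟨x, hx⟩ := hS
  let f : EuclideanSpace ℝ J →ₗ[ℝ] I → ℝ :=
    S.A.mulVecLin ∘ₗ (WithLp.linearEquiv 2 ℝ (J → ℝ)).toLinearMap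
  have hf : ∀ y, f y = S.A *ᵥ y.ofLp := fun y => rfl
  let U := LinearMap.ker f
  let x' : EuclideanSpace ℝ J := WithLp.toLp 2 x
  have hq : f (U.starProjection (z - x')) = 0 := (U.starProjection_apply_mem (z - x') : _)
  refine ⟨x' + U.starProjection (z - x'), ?_, fun y hy => ?_⟩
  · rw [← hf, map_add, hq, add_zero]; exact hx
  · have hmem : y - (x' + U.starProjection (z - x')) ∈ U := by
      rw [LinearMap.mem_ker, map_sub, map_add, hq, add_zero, hf, hf, hy]
      simp [x', hx]
    have := U.starProjection_inner_eq_zero (z - x') _ hmem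
    rwa [sub_sub] at this

/-- The inequality `h x ≤ δ` with `h ≠ 0` is valid for `S` and violated by at least `r` at `z`. -/
def Separates (S : LinSys I K J) (z : EuclideanSpace ℝ J) (r : ℝ) (h : EuclideanSpace ℝ J)
    (δ : ℝ) : Prop :=
  h ≠ 0 ∧ (∀ x : EuclideanSpace ℝ J, S.Feasible x.ofLp → inner ℝ h x ≤ δ) ∧
    r * ‖h‖ ≤ inner ℝ h z - δ

/-- The guarantee on the outcome of a call of D&C with parameters `z, r, ε`. -/
def OutcomeOK (S : LinSys I K J) (ε : ℝ) (z : EuclideanSpace ℝ J) (r : ℝ) :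
    Outcome (EuclideanSpace ℝ J) → Prop
  | .solution x => S.A *ᵥ x.ofLp = S.b ∧ ∀ k, (S.C *ᵥ x.ofLp) k < S.d k + ε
  | .hyperplane h δ => Separates S z r h δ
  | .failure => ∀ x, ¬ S.Feasible x

theorem LinSys.norm_row_le [Finite K] (S : LinSys I K J) (k : K) : ‖S.row k‖ ≤ S.normCmax :=
  le_ciSup (f := fun k => ‖S.row k‖) (Set.finite_range _).bddAbove k

/-- For a returned point, `c_k z` exceeds `d_k` by less than `r ‖c_k‖` and passing to `p` adds at
most `r ‖c_k‖`, in total less than `ε` for small `r`. In the projection case `z - p` is orthogonal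
to the affine subspace, so the inequality holds with equality on it. -/
theorem EP.outcomeOK [Finite K] {S : LinSys I K J} (hrow : ∀ k, S.row k ≠ 0) {ε r : ℝ}
    {z : EuclideanSpace ℝ J} {o} (hr : 0 < r) (hrε : r ≤ ε / (2 * S.normCmax))
    (ho : EP S z r o) : OutcomeOK S ε z r o := by
  cases ho with
  | solution p hp h₁ h₂ =>
    refine ⟨hp.1, fun k => ?_⟩
    have hk : 0 < ‖S.row k‖ := norm_pos_iff.mpr (hrow k)
    have h3 := (div_lt_iff₀ hk).mp (h₂ k)
    have h4 : inner ℝ (S.row k) (p - z) ≤ ‖S.row k‖ * r :=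
      (real_inner_le_norm _ _).trans (by gcongr)
    rw [inner_sub_right, inner_row, inner_row] at h4
    have h5 : r * (2 * S.normCmax) ≤ ε :=
      (le_div_iff₀ (by linarith [S.norm_row_le k])).mp hrε
    nlinarith [S.norm_row_le k]
  | affine p hp h₁ =>
    have hn : ‖z - p‖ = ‖p - z‖ := norm_sub_rev _ _
    have hne : 0 < ‖z - p‖ := by linarith
    refine ⟨norm_pos_iff.mp hne, fun x hx => ?_, ?_⟩
    · have := hp.2 x hx.1
      rw [inner_sub_right] at this
      linarith
    · rw [← inner_sub_right, real_inner_self_eq_norm_sq, sq]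
      gcongr
      linarith
  | violated p hp h₁ k h₂ =>
    refine ⟨hrow k, fun x hx => ?_, ?_⟩
    · rw [inner_row]; exact hx.2 k
    · rw [inner_row]
      exact (le_div_iff₀ (norm_pos_iff.mpr (hrow k))).mp h₂

theorem EP.exists {S : LinSys I K J} (hS : ∃ x, S.A *ᵥ x = S.b) (z : EuclideanSpace ℝ J) (r : ℝ) :
    ∃ o, EP S z r o := by
  obtain ⟨p, hp⟩ := S.exists_isProj hS z
  by_cases h₁ : r ≤ ‖p - z‖
  · exact ⟨_, .affine p hp h₁⟩
  by_cases h₂ : ∃ k, r ≤ ((S.C *ᵥ z.ofLp) k - S.d k) / ‖S.row k‖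
  · obtain ⟨k, hk⟩ := h₂
    exact ⟨_, .violated p hp (not_le.mp h₁) k hk⟩
  · push Not at h₁ h₂
    exact ⟨_, .solution p hp h₁ h₂⟩

/-! ### Combining two violated inequalities -/

theorem inner_projHyperplane {h : EuclideanSpace ℝ J} (hh : h ≠ 0) (δ : ℝ)
    (z : EuclideanSpace ℝ J) : inner ℝ h (projHyperplane h δ z) = δ := by
  have : inner ℝ h h ≠ 0 := inner_self_ne_zero.mpr hh
  rw [projHyperplane, inner_sub_right, inner_smul_right, div_mul_cancel₀ _ this]
  ring

/-- Two valid unit normals at angle `arccos c`, violated by `d₁` and `d₂`, have a conic combination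
violated by at least `√2 ρ`. -/
theorem exists_conic_combination {ρ d₁ d₂ c : ℝ} (hρ : 0 < ρ) (h₁ : ρ ≤ d₁) (h₂ : ρ ≤ d₂)
    (hc : -1 < c) (hc' : c ≤ 1) : ∃ x y : ℝ, 0 ≤ x ∧ 0 ≤ y ∧ 0 < x + y ∧
      0 < x ^ 2 + y ^ 2 + 2 * x * y * c ∧ 0 ≤ x * d₁ + y * (d₂ + d₁ * c) ∧
      2 * ρ ^ 2 * (x ^ 2 + y ^ 2 + 2 * x * y * c) ≤ (x * d₁ + y * (d₂ + d₁ * c)) ^ 2 := by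
  have hd₁ : 0 < d₁ := hρ.trans_le h₁
  have hd₂ : 0 < d₂ := hρ.trans_le h₂
  have hs₁ : ρ ^ 2 ≤ d₁ ^ 2 := by gcongr
  have hs₂ : ρ ^ 2 ≤ d₂ ^ 2 := by gcongr
  -- The weights `x = d₁ (1 - c²) - d₂ c`, `y = d₂` are those of the projection of `z` onto the
  -- intersection of both hyperplanes, at squared distance `d₁² + d₂² / (1 - c²)`. If this `x` is
  -- negative, the second inequality alone suffices.
  by_cases hx : 0 ≤ d₁ * (1 - c ^ 2) - d₂ * c
  · have hcne : c ≠ 1 := by rintro rfl; nlinarith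
    have hq : 0 < 1 - c ^ 2 := by
      have : c < 1 := lt_of_le_of_ne hc' hcne
      nlinarith
    have hN : (d₁ * (1 - c ^ 2) - d₂ * c) * d₁ + d₂ * (d₂ + d₁ * c) =
        d₁ ^ 2 * (1 - c ^ 2) + d₂ ^ 2 := by ring
    have hQ : (d₁ * (1 - c ^ 2) - d₂ * c) ^ 2 + d₂ ^ 2 +
        2 * (d₁ * (1 - c ^ 2) - d₂ * c) * d₂ * c =
        (1 - c ^ 2) * (d₁ ^ 2 * (1 - c ^ 2) + d₂ ^ 2) := by ring
    have hpos : 0 < d₁ ^ 2 * (1 - c ^ 2) + d₂ ^ 2 := by positivity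
    refine ⟨_, d₂, hx, hd₂.le, by linarith, ?_, ?_, ?_⟩
    · rw [hQ]; positivity
    · rw [hN]; exact hpos.le
    · rw [hN, hQ, sq (d₁ ^ 2 * (1 - c ^ 2) + d₂ ^ 2), ← mul_assoc]
      gcongr
      have : ρ ^ 2 * (1 - c ^ 2) ≤ d₁ ^ 2 * (1 - c ^ 2) := by gcongr
      nlinarith [sq_nonneg (ρ * c)]
  · have hx' : d₁ * (1 - c ^ 2) < d₂ * c := by linarith
    have hcpos : 0 < c := by
      by_contra hneg
      have : 0 ≤ 1 - c ^ 2 := by nlinarith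
      nlinarith [mul_nonneg hd₁.le this]
    refine ⟨0, 1, le_rfl, zero_le_one, by norm_num, by norm_num, by positivity, ?_⟩
    have h1 : d₁ * (d₁ * (1 - c ^ 2)) ≤ d₁ * (d₂ * c) := by gcongr
    have h2 : 0 ≤ d₁ ^ 2 * (1 - c ^ 2) := by
      have : 0 ≤ 1 - c ^ 2 := by nlinarith
      positivity
    nlinarith

/-- The combination step of D&C is always possible: two successive violated inequalities whose
normals are not opposite have a convex combination violated by `(1 + θ)` times as much. -/
theorem exists_combination {h₁ h₂ z : EuclideanSpace ℝ J} {δ₁ δ₂ ρ : ℝ} (hρ : 0 < ρ)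
    (hh₁ : h₁ ≠ 0) (hh₂ : h₂ ≠ 0) (hs₁ : ρ * ‖h₁‖ ≤ inner ℝ h₁ z - δ₁)
    (hs₂ : ρ * ‖h₂‖ ≤ inner ℝ h₂ (projHyperplane h₁ δ₁ z) - δ₂)
    (hop : ¬ ∃ γ : ℝ, 0 < γ ∧ h₁ = -(γ • h₂)) :
    ∃ α : ℝ, 0 ≤ α ∧ α ≤ 1 ∧ (1 + theta) * ρ ≤
      (inner ℝ (α • h₁ + (1 - α) • h₂) z - (α * δ₁ + (1 - α) * δ₂)) /
        ‖α • h₁ + (1 - α) • h₂‖ := by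
  have ha : 0 < ‖h₁‖ := norm_pos_iff.mpr hh₁
  have hb : 0 < ‖h₂‖ := norm_pos_iff.mpr hh₂
  set a := ‖h₁‖ with hadef
  set b := ‖h₂‖ with hbdef
  set g := inner ℝ h₁ h₂ with hg
  have hc' : g / (a * b) ≤ 1 := by
    rw [div_le_one (by positivity)]; exact real_inner_le_norm _ _
  -- Equality in Cauchy–Schwarz would make the normals opposite, which `hop` excludes.
  have hc : -1 < g / (a * b) := by
    refine lt_of_le_of_ne ?_ fun heq => hop ?_
    · rw [le_div_iff₀ (by positivity)]
      linarith [neg_le_of_abs_le (abs_real_inner_le_norm h₁ h₂)]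
    · obtain ⟨-, γ, hγ, h⟩ := (real_inner_div_norm_mul_norm_eq_neg_one_iff _ _).mp heq.symm
      refine ⟨-γ⁻¹, by simpa using hγ, ?_⟩
      rw [h, neg_smul, neg_neg, inv_smul_smul₀ hγ.ne]
  obtain ⟨x, y, hx, hy, hxy, hQ, hN, hQN⟩ := exists_conic_combination hρ
    ((le_div_iff₀ ha).mpr hs₁) ((le_div_iff₀ hb).mpr hs₂) hc hc'
  set c := g / (a * b) with hcdef
  set d₁ := (inner ℝ h₁ z - δ₁) / a with hd₁
  set d₂ := (inner ℝ h₂ (projHyperplane h₁ δ₁ z) - δ₂) / b with hd₂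
  have hσ : 0 < x / a + y / b := by
    rcases hx.lt_or_eq with h | h
    · have := div_pos h ha
      have := div_nonneg hy hb.le
      linarith
    · have := div_pos (show 0 < y by linarith) hb
      have := div_nonneg hx ha.le
      linarith
  set σ := x / a + y / b with hσdef
  have hα : 1 - x / a / σ = y / b / σ := by
    rw [eq_div_iff hσ.ne', sub_mul, div_mul_cancel₀ _ hσ.ne', hσdef]; ring
  have hg' : g = c * (a * b) := by rw [hcdef, div_mul_cancel₀ _ (by positivity)]
  have hnorm : ‖(x / a / σ) • h₁ + (y / b / σ) • h₂‖ ^ 2 =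
      (x ^ 2 + y ^ 2 + 2 * x * y * c) / σ ^ 2 := by
    rw [norm_add_sq_real, norm_smul, norm_smul, inner_smul_left, inner_smul_right, ← hg, ← hadef,
      ← hbdef, hg', mul_pow, mul_pow, Real.norm_eq_abs, Real.norm_eq_abs, sq_abs, sq_abs,
      conj_trivial]
    field_simp
    ring
  have hval : inner ℝ ((x / a / σ) • h₁ + (y / b / σ) • h₂) z -
      ((x / a / σ) * δ₁ + (y / b / σ) * δ₂) = (x * d₁ + y * (d₂ + d₁ * c)) / σ := by
    have e₁ : inner ℝ h₁ z = d₁ * a + δ₁ := by rw [hd₁, div_mul_cancel₀ _ ha.ne']; ring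
    have e₂ : inner ℝ h₂ z = d₂ * b + δ₂ + d₁ * a * g / a ^ 2 := by
      rw [hd₂, div_mul_cancel₀ _ hb.ne', projHyperplane, inner_sub_right, inner_smul_right,
        real_inner_comm h₁ h₂, ← hg, real_inner_self_eq_norm_sq, ← hadef, e₁]
      ring
    rw [inner_add_left, inner_smul_left, inner_smul_left, e₁, e₂, hg', conj_trivial, conj_trivial]
    field_simp
    ring
  -- The conic weights refer to unit normals; dividing by the norms and by `σ` turns them into
  -- convex weights for `h₁`, `h₂`.
  refine ⟨x / a / σ, by positivity, ?_, ?_⟩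
  · have : 0 ≤ y / b / σ := by positivity
    linarith
  rw [hα, hval]
  have hpos : 0 < ‖(x / a / σ) • h₁ + (y / b / σ) • h₂‖ := by
    refine lt_of_le_of_ne (norm_nonneg _) fun h => ?_
    rw [← h, zero_pow two_ne_zero] at hnorm
    exact absurd hnorm (by positivity)
  rw [le_div_iff₀ hpos]
  refine abs_le_of_sq_le_sq' ?_ (by positivity) |>.2
  rw [mul_pow, hnorm, div_pow, ← mul_div_assoc]
  gcongr
  refine le_trans ?_ hQN
  gcongr
  -- This is where `θ = 2/5` is used: `(7/5)² = 1.96 ≤ 2`.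
  rw [theta]
  nlinarith [sq_nonneg ρ]

/-- Convex combinations of valid inequalities are valid, so any `α` passing the distance test is
acceptable, not only the one constructed above. -/
theorem Separates.combine {S : LinSys I K J} {z z₁ z₂ h₁ h₂ : EuclideanSpace ℝ J}
    {r r₁ r₂ δ₁ δ₂ α : ℝ} (hr : 0 < r) (hs₁ : Separates S z₁ r₁ h₁ δ₁)
    (hs₂ : Separates S z₂ r₂ h₂ δ₂) (hα₀ : 0 ≤ α) (hα₁ : α ≤ 1)
    (hα : r ≤ (inner ℝ (α • h₁ + (1 - α) • h₂) z - (α * δ₁ + (1 - α) * δ₂)) /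
      ‖α • h₁ + (1 - α) • h₂‖) :
    Separates S z r (α • h₁ + (1 - α) • h₂) (α * δ₁ + (1 - α) * δ₂) := by
  -- Division by zero gives 0, so a zero normal would contradict `0 < r`.
  have hne : α • h₁ + (1 - α) • h₂ ≠ 0 := fun h => by
    rw [h, norm_zero, div_zero] at hα; linarith
  refine ⟨hne, fun x hx => ?_, (le_div_iff₀ (norm_pos_iff.mpr hne)).mp hα⟩
  rw [inner_add_left, inner_smul_left, inner_smul_left, conj_trivial, conj_trivial]
  exact add_le_add (mul_le_mul_of_nonneg_left (hs₁.2.1 x hx) hα₀)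
    (mul_le_mul_of_nonneg_left (hs₂.2.1 x hx) (by linarith))

/-! ### Invariant and progress of D&C -/

/-- The pending calls of a run of D&C, started at `z₀, r₀`, that is executing a call at `z, r`. -/
def StackOK (S : LinSys I K J) (z₀ : EuclideanSpace ℝ J) (r₀ : ℝ) :
    List (Frame (EuclideanSpace ℝ J)) → EuclideanSpace ℝ J → ℝ → Prop
  | [], z, r => z = z₀ ∧ r = r₀
  | .first z' r' :: L, z, r => z = z' ∧ r = r' / (1 + theta) ∧ StackOK S z₀ r₀ L z' r'
  | .second z' r' h δ :: L, z, r => z = projHyperplane h δ z' ∧ r = r' / (1 + theta) ∧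
      Separates S z' r h δ ∧ StackOK S z₀ r₀ L z' r'

/-- The invariant of a run of D&C started at `z₀, r₀`. -/
def DCInv (S : LinSys I K J) (ε : ℝ) (z₀ : EuclideanSpace ℝ J) (r₀ : ℝ) :
    DCState (EuclideanSpace ℝ J) → Prop
  | .call z r L => 0 < r ∧ StackOK S z₀ r₀ L z r
  | .ret o L => ∃ z r, 0 < r ∧ StackOK S z₀ r₀ L z r ∧ OutcomeOK S ε z r o

theorem one_add_theta_pos : 0 < 1 + theta := by norm_num [theta]

theorem StackOK.parent {S : LinSys I K J} {z₀ : EuclideanSpace ℝ J} {r₀ : ℝ} {F L z r}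
    (hr : 0 < r) (h : StackOK S z₀ r₀ (F :: L) z r) :
    ∃ z' r', 0 < r' ∧ StackOK S z₀ r₀ L z' r' := by
  cases F with
  | first z' r' =>
    obtain ⟨-, rfl, h⟩ := h
    exact ⟨z', r', (div_pos_iff_of_pos_right one_add_theta_pos).mp hr, h⟩
  | second z' r' h₁ δ₁ =>
    obtain ⟨-, rfl, -, h⟩ := h
    exact ⟨z', r', (div_pos_iff_of_pos_right one_add_theta_pos).mp hr, h⟩

theorem DCInv.step [Finite K] {S : LinSys I K J} (hrow : ∀ k, S.row k ≠ 0) {ε : ℝ}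
    {z₀ : EuclideanSpace ℝ J} {r₀ : ℝ} {s s'} (hs : DCInv S ε z₀ r₀ s) (h : DCStep S ε s s') :
    DCInv S ε z₀ r₀ s' := by
  cases h with
  | base z r L o hr ho => exact ⟨z, r, hs.1, hs.2, ho.outcomeOK hrow hs.1 hr⟩
  | recurse z r L hr => exact ⟨div_pos hs.1 one_add_theta_pos, rfl, rfl, hs.2⟩
  | found x F L =>
    obtain ⟨z, r, hr, hL, ho⟩ := hs
    obtain ⟨z', r', hr', hL'⟩ := hL.parent hr
    -- The guarantee for a solution does not mention the center or the radius, so it passes to the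
    -- parent call unchanged.
    exact ⟨z', r', hr', hL', ho⟩
  | failed F L =>
    obtain ⟨z, r, hr, hL, ho⟩ := hs
    obtain ⟨z', r', hr', hL'⟩ := hL.parent hr
    exact ⟨z', r', hr', hL', ho⟩
  | project z' r' h₁ δ₁ L =>
    obtain ⟨z, r, hr, ⟨rfl, rfl, hL⟩, ho⟩ := hs
    exact ⟨hr, rfl, rfl, ho, hL⟩
  | opposite z' r' h₁ δ₁ h₂ δ₂ L hop =>
    obtain ⟨z, r, hr, hL, hne, hval, hdist⟩ := hs
    obtain ⟨z'', r'', hr'', hL''⟩ := hL.parent hr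
    obtain ⟨rfl, -, ⟨hne₁, hval₁, -⟩, -⟩ := hL
    refine ⟨z'', r'', hr'', hL'', fun x hx => ?_⟩
    obtain ⟨γ, hγ, hγe⟩ := hop
    -- The projected center lies on the first hyperplane. With opposite normals, the first
    -- inequality says that `h₂ x` is at least its value at this center, which exceeds `δ₂` by at
    -- least `r ‖h₂‖ > 0`; the second says `h₂ x ≤ δ₂`.
    have h1 := inner_projHyperplane hne₁ δ₁ z'
    have h2 := hval₁ (WithLp.toLp 2 x) hx
    have h3 := hval (WithLp.toLp 2 x) hx
    have h4 : 0 < r * ‖h₂‖ := mul_pos hr (norm_pos_iff.mpr hne)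
    have h5 : ∀ y, inner ℝ h₁ y = -(γ * inner ℝ h₂ y) := fun y => by
      rw [hγe, inner_neg_left, inner_smul_left, conj_trivial]
    rw [h5] at h1 h2
    nlinarith
  | combine z' r' h₁ δ₁ h₂ δ₂ L α hop hα₀ hα₁ hα =>
    obtain ⟨z, r, hr, hL, ho⟩ := hs
    obtain ⟨-, rfl, hsep, hL⟩ := hL
    have hr' : 0 < r' := (div_pos_iff_of_pos_right one_add_theta_pos).mp hr
    exact ⟨z', r', hr', hL, hsep.combine hr' ho hα₀ hα₁ hα⟩

/-- D&C never gets stuck. -/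
theorem DCInv.progress {S : LinSys I K J} (hS : ∃ x, S.A *ᵥ x = S.b) {ε : ℝ}
    {z₀ : EuclideanSpace ℝ J} {r₀ : ℝ} {s} (hs : DCInv S ε z₀ r₀ s) :
    (∃ s', DCStep S ε s s') ∨ ∃ o, s = .ret o [] := by
  match s, hs with
  | .call z r L, hs =>
    left
    by_cases hr : r ≤ ε / (2 * S.normCmax)
    · obtain ⟨o, ho⟩ := EP.exists hS z r
      exact ⟨_, .base z r L o hr ho⟩
    · exact ⟨_, .recurse z r L hr⟩
  | .ret o [], hs => exact .inr ⟨o, rfl⟩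
  | .ret (.solution x) (F :: L), hs => exact .inl ⟨_, .found x F L⟩
  | .ret .failure (F :: L), hs => exact .inl ⟨_, .failed F L⟩
  | .ret (.hyperplane h δ) (.first z r :: L), hs => exact .inl ⟨_, .project z r h δ L⟩
  | .ret (.hyperplane h₂ δ₂) (.second z' r' h₁ δ₁ :: L), hs =>
    left
    by_cases hop : ∃ γ : ℝ, 0 < γ ∧ h₁ = -(γ • h₂)
    · exact ⟨_, .opposite z' r' h₁ δ₁ h₂ δ₂ L hop⟩
    obtain ⟨z, r, hr, ⟨rfl, rfl, hsep, hL⟩, ho⟩ := hs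
    obtain ⟨α, hα₀, hα₁, hα⟩ := exists_combination hr hsep.1 ho.1 hsep.2.2 ho.2.2 hop
    -- Both inequalities are violated by `r' / (1 + θ)`; the gained factor `1 + θ` restores the
    -- radius `r'` of the parent.
    rw [mul_div_cancel₀ _ one_add_theta_pos.ne'] at hα
    exact ⟨_, .combine z' r' h₁ δ₁ h₂ δ₂ L α hop hα₀ hα₁ hα⟩

/-! ### Step count of D&C -/

/-- An upper bound for the recursion depth of D&C at radius `r`, with base case `r ≤ c`. -/
noncomputable def depth (c r : ℝ) : ℕ := ⌈Real.log (r / c) / Real.log (1 + theta)⌉₊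

/-- Dividing `r` by `1 + θ` lowers the logarithm of `r / c` to base `1 + θ` by exactly 1; for `r >
c` the rounded-up value is positive, so truncated subtraction really decreases it. -/
theorem depth_div_lt {c r : ℝ} (hc : 0 < c) (hr : c < r) :
    depth c (r / (1 + theta)) < depth c r := by
  have hθ : 0 < Real.log (1 + theta) := Real.log_pos (by norm_num [theta])
  have hrc : 0 < r / c := div_pos (hc.trans hr) hc
  have hpos : 0 < Real.log (r / c) / Real.log (1 + theta) :=
    div_pos (Real.log_pos ((one_lt_div hc).mpr hr)) hθ
  rw [depth, depth, div_right_comm, Real.log_div hrc.ne' one_add_theta_pos.ne', sub_div,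
    div_self hθ.ne', Nat.ceil_sub_one]
  have := Nat.ceil_pos.mpr hpos
  omega

/-- An upper bound for the number of steps of a call of D&C with recursion depth `d`. -/
def dcCost : ℕ → ℕ
  | 0 => 1
  | d + 1 => 2 * dcCost d + 3

theorem dcCost_mono : Monotone dcCost :=
  monotone_nat_of_le_succ fun d => by rw [dcCost]; omega

theorem dcCost_pos (d : ℕ) : 0 < dcCost d := by cases d <;> simp [dcCost]

/-- An upper bound for the number of steps still to be executed by the pending calls. -/
noncomputable def stackCost {E : Type} (c : ℝ) : List (Frame E) → ℕ
  | [] => 0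
  | .first _ r :: L => 2 + dcCost (depth c (r / (1 + theta))) + stackCost c L
  | .second _ _ _ _ :: L => 1 + stackCost c L

/-- An upper bound for the number of steps of D&C from a given configuration. -/
noncomputable def stateCost {E : Type} (c : ℝ) : DCState E → ℕ
  | .call _ r L => dcCost (depth c r) + stackCost c L
  | .ret _ L => stackCost c L

theorem stackCost_lt_cons {E : Type} (c : ℝ) (F : Frame E) (L) :
    stackCost c L < stackCost c (F :: L) := by
  cases F <;> rw [stackCost] <;> omega

/-- The extra 3 in `dcCost` pays for starting the first call, for the projection, and for handling
the second result. A pending first call reserves the whole second call in `stackCost`, so returning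
early only saves steps. -/
theorem DCStep.stateCost_lt {S : LinSys I K J} {ε : ℝ} (hc : 0 < ε / (2 * S.normCmax)) {s s'}
    (h : DCStep S ε s s') :
    stateCost (ε / (2 * S.normCmax)) s' < stateCost (ε / (2 * S.normCmax)) s := by
  cases h with
  | base z r L o hr ho =>
    have := dcCost_pos (depth (ε / (2 * S.normCmax)) r)
    simp only [stateCost]
    omega
  | recurse z r L hr =>
    have h1 := dcCost_mono (Nat.succ_le_of_lt (depth_div_lt hc (not_le.mp hr)))
    simp only [dcCost] at h1
    simp only [stateCost, stackCost]
    omega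
  | found x F L => exact stackCost_lt_cons _ _ _
  | failed F L => exact stackCost_lt_cons _ _ _
  | project z' r' h₁ δ₁ L => simp only [stateCost, stackCost]; omega
  | opposite z' r' h₁ δ₁ h₂ δ₂ L hop => exact stackCost_lt_cons _ _ _
  | combine z' r' h₁ δ₁ h₂ δ₂ L α hop hα₀ hα₁ hα => exact stackCost_lt_cons _ _ _

end DC

end LFG

namespace LFG

/-! ## Rounding -/

section Rounding

theorem sum_comp_le_of_injective {α β : Type*} [Fintype α] [Fintype β] {e : α → β}
    (he : Function.Injective e) (f : β → ℕ) : ∑ a, f (e a) ≤ ∑ b, f b := by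
  classical
  rw [← Finset.sum_image (s := Finset.univ) (f := f) (fun _ _ _ _ h => he h)]
  exact Finset.sum_le_sum_of_subset (Finset.subset_univ _)

theorem one_add_sum_le_prod_one_add {α : Type*} (s : Finset α) (f : α → ℕ) :
    1 + ∑ a ∈ s, f a ≤ ∏ a ∈ s, (1 + f a) := by
  classical
  induction s using Finset.induction_on with
  | empty => simp
  | insert a s ha ih =>
    rw [Finset.sum_insert ha, Finset.prod_insert ha, add_mul, one_mul]
    have h1 : 1 ≤ ∏ a ∈ s, (1 + f a) := Finset.one_le_prod' fun _ _ => by omega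
    nlinarith [Nat.mul_le_mul_left (f a) h1]

theorem one_add_natAbs_le_two_pow_intBits (a : ℤ) : 1 + a.natAbs ≤ 2 ^ intBits a := by
  rw [add_comm]
  exact (Nat.le_pow_clog one_lt_two _).trans
    (Nat.pow_le_pow_right two_pos (by rw [intBits]; omega))

variable {m l n : ℕ}

namespace Input

/-- The rows of `A` and `C` together. -/
def rows (D : Input m l n) : Fin m ⊕ Fin l → Fin n → ℤ := Sum.elim D.A D.C

/-- The right-hand sides `b` and `d` together. -/
def rhs (D : Input m l n) : Fin m ⊕ Fin l → ℤ := Sum.elim D.b D.d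

/-- The bit length of a row and its right-hand side. -/
def rowBits (D : Input m l n) (s : Fin m ⊕ Fin l) : ℕ :=
  ∑ j, intBits (D.rows s j) + intBits (D.rhs s)

theorem sum_rowBits (D : Input m l n) : ∑ s, D.rowBits s = D.bitLength := by
  simp only [rowBits, bitLength, Finset.sum_add_distrib, Fintype.sum_sum_type]
  change ((∑ i, ∑ j, intBits (D.A i j)) + ∑ k, ∑ j, intBits (D.C k j)) +
    ((∑ i, intBits (D.b i)) + ∑ k, intBits (D.d k)) = _
  ring

/-- The spare factor 2 comes from the sign bit of the right-hand side. One such factor per selected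
row later absorbs the number of summands in `∑ |μ_s|`. -/
theorem two_mul_one_add_le (D : Input m l n) (s : Fin m ⊕ Fin l) :
    2 * (1 + ∑ j, |D.rows s j|) ≤ 2 ^ D.rowBits s := by
  have h1 : 1 + ∑ j, (D.rows s j).natAbs ≤ 2 ^ ∑ j, intBits (D.rows s j) := by
    refine (one_add_sum_le_prod_one_add _ _).trans ?_
    rw [← Finset.prod_pow_eq_pow_sum]
    exact Finset.prod_le_prod' fun j _ => one_add_natAbs_le_two_pow_intBits _
  have h2 : 2 ≤ 2 ^ intBits (D.rhs s) :=
    le_self_pow₀ one_le_two (by rw [intBits]; omega)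
  have h3 : 2 * (1 + ∑ j, (D.rows s j).natAbs) ≤ 2 ^ D.rowBits s := by
    rw [rowBits, pow_add, mul_comm]
    exact Nat.mul_le_mul h1 h2
  zify at h3
  exact h3

theorem nu_pos (D : Input m l n) : 0 < D.nu := by rw [nu]; positivity

theorem dotProduct_rows_inr (D : Input m l n) (k : Fin l) (x : Fin n → ℝ) :
    ∑ j, (D.rows (.inr k) j : ℝ) * x j = (D.toSys.C *ᵥ x) k := rfl

/-- The real rows `a_i`, `i ∈ I'`, and `c_k`, `k ∈ L'`, as a single family. -/
theorem elim_rows (D : Input m l n) (I' : Set (Fin m)) (L' : Set (Fin l)) :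
    (Sum.elim (fun i : I' => D.toSys.A i) (fun k : L' => D.toSys.C k)) =
      fun s j => (D.rows (Sum.map Subtype.val Subtype.val s) j : ℝ) := by
  funext s; cases s <;> rfl

theorem rowSpan_eq (D : Input m l n) (I' : Set (Fin m)) (L' : Set (Fin l)) :
    D.rowSpan I' L' = Submodule.span ℝ (Set.range
      (Sum.elim (fun i : I' => D.toSys.A i) (fun k : L' => D.toSys.C k))) := by
  rw [rowSpan, Set.Sum.elim_range]
  congr 2 <;> exact Set.image_eq_range _ _

/-- The approximate solutions that are rounded. -/
def IsApprox (D : Input m l n) (x : Fin n → ℝ) : Prop :=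
  D.toSys.A *ᵥ x = D.toSys.b ∧ ∀ k, (D.toSys.C *ᵥ x) k < D.toSys.d k + D.nu

theorem exists_move (D : Input m l n) {x : Fin n → ℝ} {k : Fin l} (hk : k ∉ D.active x)
    (hspan : D.toSys.C k ∉ D.rowSpan Set.univ (D.active x)) :
    ∃ s', Step D (.rounding x) s' := by
  obtain ⟨w, hw, hwk⟩ := exists_dotProduct_eq_one _ _ hspan
  have hwL : ∀ i ∈ D.active x, (D.toSys.C *ᵥ w) i = 0 := fun i hi => hw _ (.inr ⟨i, hi, rfl⟩)
  obtain ⟨j, hj, hmin⟩ := Set.exists_min_image {i | i ∉ D.active x ∧ 0 < (D.toSys.C *ᵥ w) i}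
    (fun i => (D.toSys.d i - (D.toSys.C *ᵥ x) i) / (D.toSys.C *ᵥ w) i) (Set.toFinite _)
    ⟨k, hk, lt_of_lt_of_eq one_pos hwk.symm⟩
  exact ⟨_, .move x w k j hk hspan (funext fun i => hw _ (.inl ⟨i, trivial, rfl⟩)) hwL hwk hj.1
    hj.2 fun i hi hiw => hmin i ⟨hi, hiw⟩⟩

theorem IsApprox.lt_of_not_active {D : Input m l n} {x : Fin n → ℝ} (hx : D.IsApprox x)
    {k : Fin l} (hk : k ∉ D.active x) : (D.toSys.C *ᵥ x) k < D.toSys.d k := by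
  by_contra h
  exact hk ⟨not_lt.mp h, hx.2 k⟩

/-- A move of the rounding phase keeps the point approximately feasible and enlarges `L_x`. -/
theorem IsApprox.move {D : Input m l n} {x w : Fin n → ℝ} {j : Fin l} (hx : D.IsApprox x)
    (hwA : D.toSys.A *ᵥ w = 0) (hwL : ∀ i ∈ D.active x, (D.toSys.C *ᵥ w) i = 0)
    (hj : j ∉ D.active x) (hwj : 0 < (D.toSys.C *ᵥ w) j)
    (hmin : ∀ i, i ∉ D.active x → 0 < (D.toSys.C *ᵥ w) i →
      (D.toSys.d j - (D.toSys.C *ᵥ x) j) / (D.toSys.C *ᵥ w) j ≤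
        (D.toSys.d i - (D.toSys.C *ᵥ x) i) / (D.toSys.C *ᵥ w) i) :
    D.IsApprox (x + ((D.toSys.d j - (D.toSys.C *ᵥ x) j) / (D.toSys.C *ᵥ w) j) • w) ∧
    D.active x ⊂
      D.active (x + ((D.toSys.d j - (D.toSys.C *ᵥ x) j) / (D.toSys.C *ᵥ w) j) • w) := by
  set t := (D.toSys.d j - (D.toSys.C *ᵥ x) j) / (D.toSys.C *ᵥ w) j with ht
  have ht0 : 0 < t := div_pos (by linarith [hx.lt_of_not_active hj]) hwj
  have hν := D.nu_pos
  have hC : ∀ i, (D.toSys.C *ᵥ (x + t • w)) i = (D.toSys.C *ᵥ x) i + t * (D.toSys.C *ᵥ w) i :=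
    fun i => by rw [Matrix.mulVec_add, Matrix.mulVec_smul]; rfl
  refine ⟨⟨?_, fun i => ?_⟩, ?_⟩
  · rw [Matrix.mulVec_add, Matrix.mulVec_smul, hwA, smul_zero, add_zero, hx.1]
  · rw [hC]
    by_cases hi : i ∈ D.active x
    · rw [hwL i hi, mul_zero, add_zero]; exact hx.2 i
    · have h1 := hx.lt_of_not_active hi
      rcases lt_or_ge 0 ((D.toSys.C *ᵥ w) i) with hiw | hiw
      · have := (le_div_iff₀ hiw).mp (hmin i hi hiw)
        linarith
      · nlinarith
  · rw [Set.ssubset_iff_of_subset]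
    · refine ⟨j, ?_, hj⟩
      have h : (D.toSys.C *ᵥ (x + t • w)) j = D.toSys.d j := by
        rw [hC, ht, div_mul_cancel₀ _ hwj.ne']; ring
      exact ⟨h.ge, by rw [h]; linarith⟩
    · intro i hi
      have h : (D.toSys.C *ᵥ (x + t • w)) i = (D.toSys.C *ᵥ x) i := by
        rw [hC, hwL i hi, mul_zero, add_zero]
      exact ⟨by rw [h]; exact hi.1, by rw [h]; exact hi.2⟩

theorem exists_finish (D : Input m l n) {x : Fin n → ℝ}
    (hspan : ∀ k, k ∉ D.active x → D.toSys.C k ∈ D.rowSpan Set.univ (D.active x)) :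
    ∃ s', Step D (.rounding x) s' := by
  classical
  set v : Fin m ⊕ Fin l → Fin n → ℝ := Sum.elim D.toSys.A D.toSys.C with hv
  -- A basis is first chosen among the rows of `A` and only then extended by active rows of `C`;
  -- this order makes `I'` span all rows of `A`.
  obtain ⟨b₁, hb₁, -, hsp₁, hli₁⟩ := exists_linearIndepOn_extension (v := v)
    (linearIndepOn_empty ℝ v) (Set.empty_subset (Set.range Sum.inl))
  obtain ⟨b₂, hb₂, hb₁₂, hsp₂, hli₂⟩ := exists_linearIndepOn_extension (v := v) hli₁
    (hb₁.trans (Set.subset_union_left (t := Sum.inr '' D.active x)))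
  set I' : Set (Fin m) := Sum.inl ⁻¹' b₂
  set L' : Set (Fin l) := Sum.inr ⁻¹' b₂
  have hL : L' ⊆ D.active x := fun k hk => by
    rcases hb₂ hk with ⟨i, hi⟩ | ⟨k', hk', h⟩
    · cases hi
    · cases h; exact hk'
  have hindep : LinearIndependent ℝ
      (Sum.elim (fun i : I' => D.toSys.A i) (fun k : L' => D.toSys.C k)) := by
    let f : I' ⊕ L' → b₂ := Sum.elim (fun i => ⟨.inl i, i.2⟩) (fun k => ⟨.inr k, k.2⟩)
    have hf : Function.Injective f := by
      rintro (⟨i, hi⟩ | ⟨i, hi⟩) (⟨j, hj⟩ | ⟨j, hj⟩) h <;> simp_all [f]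
    have hcomp : (Sum.elim (fun i : I' => D.toSys.A i) (fun k : L' => D.toSys.C k)) =
        (fun s : b₂ => v s) ∘ f := by funext s; cases s <;> rfl
    rw [hcomp]
    exact hli₂.linearIndependent.comp f hf
  have hI : D.rowSpan I' ∅ = D.rowSpan Set.univ ∅ := by
    refine le_antisymm (Submodule.span_mono (Set.union_subset_union_left _
      (Set.image_mono (Set.subset_univ _))))
      (Submodule.span_le.mpr ?_)
    rintro _ (⟨i, -, rfl⟩ | ⟨k, hk, -⟩)
    · refine Submodule.span_mono ?_ (hsp₁ ⟨.inl i, ⟨i, rfl⟩, rfl⟩)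
      rintro _ ⟨s, hs, rfl⟩
      obtain ⟨i', rfl⟩ := hb₁ hs
      exact .inl ⟨i', hb₁₂ hs, rfl⟩
    · exact absurd hk (Set.notMem_empty _)
  have hmax : D.rowSpan I' L' = D.rowSpan Set.univ (D.active x) := by
    refine le_antisymm (Submodule.span_mono (Set.union_subset_union
      (Set.image_mono (Set.subset_univ _)) (Set.image_mono hL)))
      (Submodule.span_le.mpr ?_)
    have hle : Submodule.span ℝ (v '' b₂) ≤ D.rowSpan I' L' := by
      refine Submodule.span_mono ?_
      rintro _ ⟨s, hs, rfl⟩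
      cases s with
      | inl i => exact .inl ⟨i, hs, rfl⟩
      | inr k => exact .inr ⟨k, hs, rfl⟩
    rintro _ (⟨i, -, rfl⟩ | ⟨k, hk, rfl⟩)
    · exact hle (hsp₂ ⟨.inl i, .inl ⟨i, rfl⟩, rfl⟩)
    · exact hle (hsp₂ ⟨.inr k, .inr ⟨k, hk, rfl⟩, rfl⟩)
  have hindep' := hindep
  rw [elim_rows] at hindep'
  obtain ⟨Δ, -, -, -, hsol⟩ := exists_cramer _ hindep'
  obtain ⟨y, hy, -⟩ := hsol fun s => D.rhs (Sum.map Subtype.val Subtype.val s)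
  exact ⟨_, .finish x y I' L' hspan hL hindep hI hmax
    (fun i hi => hy (.inl ⟨i, hi⟩)) fun k hk => hy (.inr ⟨k, hk⟩)⟩

/-- The final point of the rounding phase is an exact solution. -/
theorem IsApprox.feasible_of_finish {D : Input m l n} {x y : Fin n → ℝ} (hx : D.IsApprox x)
    {I' : Set (Fin m)} {L' : Set (Fin l)}
    (hspan : ∀ k, k ∉ D.active x → D.toSys.C k ∈ D.rowSpan Set.univ (D.active x))
    (hL : L' ⊆ D.active x)
    (hindep : LinearIndependent ℝ
      (Sum.elim (fun i : I' => D.toSys.A i) (fun k : L' => D.toSys.C k)))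
    (hI : D.rowSpan I' ∅ = D.rowSpan Set.univ ∅)
    (hmax : D.rowSpan I' L' = D.rowSpan Set.univ (D.active x))
    (hyA : ∀ i ∈ I', (D.toSys.A *ᵥ y) i = D.toSys.b i)
    (hyL : ∀ k ∈ L', (D.toSys.C *ᵥ y) k = D.toSys.d k) : D.toSys.Feasible y := by
  classical
  refine ⟨funext fun i => ?_, fun k => ?_⟩
  · rw [← hx.1]
    refine dotProduct_eq_of_mem_span (s := D.toSys.A '' I' ∪ D.toSys.C '' ∅) (u := D.toSys.A i) ?_ ?_
    · rintro _ (⟨i, hi, rfl⟩ | ⟨k, hk, -⟩)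
      · exact (hyA i hi).trans (congrFun hx.1 i).symm
      · exact absurd hk (Set.notMem_empty _)
    change D.toSys.A i ∈ D.rowSpan I' ∅
    rw [hI]
    exact Submodule.subset_span (.inl ⟨i, trivial, rfl⟩)
  have hk : D.toSys.C k ∈ D.rowSpan I' L' := by
    rw [hmax]
    by_cases hk : k ∈ D.active x
    · exact Submodule.subset_span (.inr ⟨k, hk, rfl⟩)
    · exact hspan k hk
  set σ : I' ⊕ L' → Fin m ⊕ Fin l := Sum.map Subtype.val Subtype.val with hσ
  have hσinj : Function.Injective σ := Subtype.val_injective.sumMap Subtype.val_injective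
  rw [rowSpan_eq, elim_rows, Submodule.mem_span_range_iff_exists_fun] at hk
  obtain ⟨c, hc⟩ := hk
  have hc' : ∀ j, (D.C k j : ℝ) = ∑ s, c s * D.rows (σ s) j := fun j => by
    have := congrFun hc j
    rw [Finset.sum_apply] at this
    exact this.symm
  rw [elim_rows] at hindep
  obtain ⟨Δ, hΔ, hΔle, hcr, -⟩ := exists_cramer _ hindep
  obtain ⟨μ, hμ, hμle⟩ := hcr (D.C k) c hc'
  have hexp : ∀ z : Fin n → ℝ, Δ * (D.toSys.C *ᵥ z) k =
      ∑ s, μ s * ∑ j, (D.rows (σ s) j : ℝ) * z j := fun z => by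
    rw [← dotProduct_rows_inr]
    change Δ * ∑ j, (D.C k j : ℝ) * z j = _
    simp_rw [hc', ← hμ, Finset.mul_sum, Finset.sum_mul, Finset.mul_sum]
    rw [Finset.sum_comm]
    simp only [mul_assoc]
  have hy : ∀ s, ∑ j, (D.rows (σ s) j : ℝ) * y j = D.rhs (σ s) := by
    rintro (i | k)
    · exact hyA i i.2
    · exact hyL k k.2
  have herr : ∀ s, |∑ j, (D.rows (σ s) j : ℝ) * x j - D.rhs (σ s)| ≤ D.nu := by
    rintro (i | k)
    · have h : ∑ j, (D.rows (σ (.inl i)) j : ℝ) * x j = D.rhs (σ (.inl i)) := congrFun hx.1 i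
      rw [h, sub_self, abs_zero]
      exact D.nu_pos.le
    · have h1 := (hL k.2).1
      have h2 := (hL k.2).2
      rw [abs_le]
      change -D.nu ≤ (D.toSys.C *ᵥ x) k - D.toSys.d k ∧ (D.toSys.C *ᵥ x) k - D.toSys.d k ≤ D.nu
      have := D.nu_pos
      constructor <;> linarith
  -- One factor `2^T` bounds `R`, the contribution of `c_k`. The other bounds `W`, the product over
  -- the selected rows, together with the number of terms, via `card + 1 ≤ 2 ^ card`.
  have hbound : |Δ| + ∑ s, |μ s| ≤ (2 : ℤ) ^ (2 * D.bitLength) := by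
    set W : ℤ := ∏ s, (1 + ∑ j, |D.rows (σ s) j|) with hW
    set R : ℤ := 1 + ∑ j, |D.C k j| with hR
    have hW0 : 0 ≤ W := Finset.prod_nonneg fun s _ =>
      add_nonneg zero_le_one (Finset.sum_nonneg fun _ _ => abs_nonneg _)
    have hR1 : 1 ≤ R := by
      have : 0 ≤ ∑ j, |D.C k j| := Finset.sum_nonneg fun _ _ => abs_nonneg _
      linarith
    have hRT : R ≤ 2 ^ D.bitLength := by
      have h1 := D.two_mul_one_add_le (.inr k)
      have h2 : (2 : ℤ) ^ D.rowBits (.inr k) ≤ 2 ^ D.bitLength := by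
        rw [← D.sum_rowBits]
        exact pow_le_pow_right₀ one_le_two
          (Finset.single_le_sum (f := D.rowBits) (fun _ _ => Nat.zero_le _) (Finset.mem_univ _))
      change 2 * R ≤ _ at h1
      linarith
    have hWT : 2 ^ Fintype.card (I' ⊕ L') * W ≤ 2 ^ D.bitLength := by
      have h1 : (2 : ℤ) ^ Fintype.card (I' ⊕ L') * W =
          ∏ s, (2 * (1 + ∑ j, |D.rows (σ s) j|)) := by
        rw [Finset.prod_mul_distrib, Finset.prod_const, Finset.card_univ]
      rw [h1]
      refine (Finset.prod_le_prod (fun s _ => ?_) fun s _ => D.two_mul_one_add_le (σ s)).trans ?_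
      · have : 0 ≤ ∑ j, |D.rows (σ s) j| := Finset.sum_nonneg fun _ _ => abs_nonneg _
        linarith
      · rw [Finset.prod_pow_eq_pow_sum, ← D.sum_rowBits]
        exact pow_le_pow_right₀ one_le_two (sum_comp_le_of_injective hσinj D.rowBits)
    have hcard : (Fintype.card (I' ⊕ L') : ℤ) + 1 ≤ 2 ^ Fintype.card (I' ⊕ L') := by
      exact_mod_cast Nat.lt_two_pow_self (n := Fintype.card (I' ⊕ L'))
    have hsum : ∑ s, |μ s| ≤ Fintype.card (I' ⊕ L') * (R * W) := by
      rw [← nsmul_eq_mul, ← Finset.card_univ]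
      exact Finset.sum_le_card_nsmul _ _ _ fun s _ => hμle s
    calc |Δ| + ∑ s, |μ s| ≤ R * W + Fintype.card (I' ⊕ L') * (R * W) :=
          add_le_add (hΔle.trans (le_mul_of_one_le_left hW0 hR1)) hsum
      _ = (Fintype.card (I' ⊕ L') + 1) * (R * W) := by ring
      _ ≤ 2 ^ Fintype.card (I' ⊕ L') * (R * W) := by gcongr
      _ = R * (2 ^ Fintype.card (I' ⊕ L') * W) := by ring
      _ ≤ 2 ^ D.bitLength * 2 ^ D.bitLength := by gcongr
      _ = _ := by rw [two_mul, pow_add]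
  have hboundR : D.nu * (|(Δ : ℝ)| + ∑ s, |(μ s : ℝ)|) ≤ 1 := by
    have : (|(Δ : ℝ)| + ∑ s, |(μ s : ℝ)|) ≤ 2 ^ (2 * D.bitLength) := by exact_mod_cast hbound
    rw [nu, inv_mul_le_iff₀ (by positivity), mul_one]
    exact this
  have hdiff : Δ * (D.toSys.C *ᵥ y) k - Δ * (D.toSys.C *ᵥ x) k =
      -∑ s, μ s * (∑ j, (D.rows (σ s) j : ℝ) * x j - D.rhs (σ s)) := by
    simp only [hexp, hy, mul_sub, Finset.sum_sub_distrib]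
    ring
  have hdiff' : |Δ * (D.toSys.C *ᵥ y) k - Δ * (D.toSys.C *ᵥ x) k| ≤
      D.nu * ∑ s, |(μ s : ℝ)| := by
    rw [hdiff, abs_neg, Finset.mul_sum]
    refine (Finset.abs_sum_le_sum_abs _ _).trans (Finset.sum_le_sum fun s _ => ?_)
    rw [abs_mul, mul_comm]
    gcongr
    exact herr s
  have hΔpos : 0 < |(Δ : ℝ)| := abs_pos.mpr (by exact_mod_cast hΔ)
  -- Passing from `x` to `y` costs at most `ν ∑ |μ_s|` after scaling, and `x` itself violates row
  -- `k` by less than `ν`.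
  have hlt : |(Δ : ℝ)| * ((D.toSys.C *ᵥ y) k - D.toSys.d k) < 1 := by
    have h1 : |(Δ : ℝ)| * ((D.toSys.C *ᵥ y) k - (D.toSys.C *ᵥ x) k) ≤
        D.nu * ∑ s, |(μ s : ℝ)| := by
      refine le_trans ?_ hdiff'
      rw [← mul_sub, abs_mul]
      gcongr
      exact le_abs_self _
    have h2 : |(Δ : ℝ)| * ((D.toSys.C *ᵥ x) k - D.toSys.d k) < |(Δ : ℝ)| * D.nu := by
      gcongr
      linarith [hx.2 k]
    linarith
  -- At `y` the selected rows take their integer right-hand sides exactly, so the scaled violation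
  -- is an integer.
  have hint : |(Δ : ℝ)| * ((D.toSys.C *ᵥ y) k - D.toSys.d k) =
      (Δ.sign * (∑ s, μ s * D.rhs (σ s) - Δ * D.d k) : ℤ) := by
    have h1 : (|Δ| : ℝ) = Δ.sign * Δ := by exact_mod_cast (Int.sign_mul_self_eq_abs Δ).symm
    rw [h1, mul_assoc, mul_sub, hexp]
    simp only [hy]
    push_cast
    rfl
  rw [hint] at hlt
  have hle : Δ.sign * (∑ s, μ s * D.rhs (σ s) - Δ * D.d k) ≤ 0 :=
    Int.lt_add_one_iff.mp (by exact_mod_cast hlt)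
  have hleR : |(Δ : ℝ)| * ((D.toSys.C *ᵥ y) k - D.toSys.d k) ≤ 0 := by
    rw [hint]; exact_mod_cast hle
  have := nonpos_of_mul_nonpos_right hleR hΔpos
  linarith

end Input

end Rounding

end LFG

namespace LFG

/-! ## Small points of rational polyhedra -/

section Radius

theorem mul_le_two_pow_ratSize (q : ℚ) : (1 + q.num.natAbs) * (1 + q.den) ≤ 2 ^ ratSize q := by
  rw [ratSize, add_assoc, pow_add, pow_add, add_comm 1, add_comm 1]
  have h1 := Nat.le_pow_clog one_lt_two (q.num.natAbs + 1)
  have h2 := Nat.le_pow_clog one_lt_two (q.den + 1)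
  have := Nat.mul_le_mul h1 h2
  omega

/-- Clearing denominators in a rational vector. -/
theorem exists_int_scaling {α : Type} [Fintype α] (q : α → ℚ) :
    ∃ (Q : ℕ) (a : α → ℤ), 0 < Q ∧ (∀ i, (a i : ℝ) = Q * (q i : ℝ)) ∧
      ∑ i, |a i| ≤ 2 ^ ∑ i, ratSize (q i) := by
  classical
  refine ⟨∏ i, (q i).den, fun i => (q i).num * ∏ j ∈ Finset.univ.erase i, (q j).den,
    Finset.prod_pos fun i _ => (q i).den_pos, fun i => ?_, ?_⟩
  · rw [← Finset.mul_prod_erase _ _ (Finset.mem_univ i)]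
    have h : ((q i : ℚ) : ℝ) * (q i).den = (q i).num := by exact_mod_cast (q i).mul_den_eq_num
    push_cast
    rw [← h]
    ring
  · have hnat : ∑ i, (q i).num.natAbs * ∏ j ∈ Finset.univ.erase i, (q j).den ≤
        2 ^ ∑ i, ratSize (q i) := by
      calc _ ≤ ∑ i, (q i).num.natAbs * ∏ j, (q j).den := by
            refine Finset.sum_le_sum fun i _ => Nat.mul_le_mul_left _ ?_
            rw [← Finset.mul_prod_erase _ _ (Finset.mem_univ i)]
            exact Nat.le_mul_of_pos_left _ (q i).den_pos
        _ = (∑ i, (q i).num.natAbs) * ∏ j, (q j).den := by rw [Finset.sum_mul]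
        _ ≤ (∏ i, (1 + (q i).num.natAbs)) * ∏ i, (1 + (q i).den) := by
            refine Nat.mul_le_mul ?_ (Finset.prod_le_prod' fun i _ => by omega)
            exact le_trans (by omega) (one_add_sum_le_prod_one_add _ _)
        _ ≤ ∏ i, 2 ^ ratSize (q i) := by
            rw [← Finset.prod_mul_distrib]
            exact Finset.prod_le_prod' fun i _ => mul_le_two_pow_ratSize _
        _ = _ := Finset.prod_pow_eq_pow_sum _ _ _
    zify at hnat
    simpa [abs_mul, Finset.abs_prod] using hnat

/-- A nonempty polyhedron defined by integer inequalities of `ℓ¹` norm at most `B` has a point with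
coordinates at most `B ^ N`. -/
theorem exists_small_point_int {ι J : Type} [Fintype ι] [Fintype J] (v : ι → J → ℤ) (β : ι → ℤ)
    {B : ℤ} (hB : 1 ≤ B) (hvB : ∀ i, (∑ j, |v i j|) + |β i| ≤ B)
    (hP : ∃ x : J → ℝ, ∀ i, ∑ j, (v i j : ℝ) * x j ≤ β i) :
    ∃ y : J → ℝ, (∀ i, ∑ j, (v i j : ℝ) * y j ≤ β i) ∧ ∀ j, |y j| ≤ (B : ℝ) ^ Fintype.card J := by
  classical
  set M : ι → J → ℝ := fun i j => (v i j : ℝ) with hM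
  obtain ⟨x, hx, hspan⟩ := exists_tight_span M (fun i => (β i : ℝ)) hP
  obtain ⟨b, hb, -, hsp, hli⟩ := exists_linearIndepOn_extension (v := M)
    (linearIndepOn_empty ℝ M) (Set.empty_subset {i | M i ⬝ᵥ x = β i})
  obtain ⟨-, -, -, -, hsol⟩ := exists_cramer (fun i : b => v i) hli
  obtain ⟨y, hy, hyB⟩ := hsol fun i => β i
  refine ⟨y, fun k => ?_, fun j => (hyB j).trans ?_⟩
  · have hk : M k ∈ Submodule.span ℝ (M '' b) := Submodule.span_le.mpr hsp (hspan k)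
    have heq : M k ⬝ᵥ y = M k ⬝ᵥ x := dotProduct_eq_of_mem_span (by
      rintro _ ⟨i, hi, rfl⟩
      exact (hy ⟨i, hi⟩).trans (hb hi).symm) hk
    exact heq.le.trans (hx k)
  · have hcard : Fintype.card b ≤ Fintype.card J := by
      simpa using LinearIndependent.fintype_card_le_finrank hli
    have h1 : ∏ i : b, ((∑ j, |v i j|) + |β i|) ≤ B ^ Fintype.card J := by
      refine (Finset.prod_le_prod (s := Finset.univ) (f := fun i : b => (∑ j, |v i j|) + |β i|)
        (fun i _ => add_nonneg (Finset.sum_nonneg fun _ _ => abs_nonneg _) (abs_nonneg _))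
        fun i _ => hvB i).trans ?_
      rw [Finset.prod_const, Finset.card_univ]
      exact pow_le_pow_right₀ hB hcard
    exact_mod_cast h1

theorem exists_small_point {J : Type} [Fintype J] {N φ : ℕ} (M : Matrix (Fin N) J ℚ)
    (β : Fin N → ℚ) (hφ : ∀ i, ineqSize (M i) (β i) ≤ φ)
    (hP : ∃ x : J → ℝ, ∀ i, ∑ j, (M i j : ℝ) * x j ≤ (β i : ℝ)) :
    ∃ y : J → ℝ, (∀ i, ∑ j, (M i j : ℝ) * y j ≤ (β i : ℝ)) ∧
      ∀ j, |y j| ≤ 2 ^ (Fintype.card J * φ) := by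
  choose Q a hQ ha hle using fun i => exists_int_scaling
    (fun o : Option J => o.elim (β i) (M i))
  have hiff : ∀ (x : J → ℝ) i, ∑ j, (a i (some j) : ℝ) * x j ≤ a i none ↔
      ∑ j, (M i j : ℝ) * x j ≤ (β i : ℝ) := fun x i => by
    have hQ' : (0 : ℝ) < Q i := by exact_mod_cast hQ i
    simp only [ha, Option.elim, mul_assoc]
    rw [← Finset.mul_sum, mul_le_mul_iff_right₀ hQ']
  obtain ⟨x, hx⟩ := hP
  have hB : ∀ i, (∑ j, |a i (some j)|) + |a i none| ≤ 2 ^ φ := fun i => by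
    have h1 := hle i
    rw [Fintype.sum_option, Fintype.sum_option] at h1
    have h2 : ratSize (β i) + ∑ j, ratSize (M i j) ≤ φ := by
      have := hφ i
      rw [ineqSize] at this
      omega
    have h3 : (2 : ℤ) ^ (ratSize (β i) + ∑ j, ratSize (M i j)) ≤ 2 ^ φ :=
      pow_le_pow_right₀ one_le_two h2
    simp only [Option.elim] at h1
    linarith
  obtain ⟨y, hy, hyB⟩ := exists_small_point_int (fun i j => a i (some j)) (fun i => a i none)
    (one_le_pow₀ one_le_two) hB ⟨x, fun i => (hiff x i).mpr (hx i)⟩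
  refine ⟨y, fun i => (hiff y i).mp (hy i), fun j => (hyB j).trans_eq ?_⟩
  push_cast
  rw [← pow_mul, mul_comm]

/-- `P` is the solution set of a finite system of rational linear inequalities. -/
def IsRationalPolyhedron {J : Type} [Fintype J] (P : Set (J → ℝ)) : Prop :=
  ∃ (N : ℕ) (M : Matrix (Fin N) J ℚ) (β : Fin N → ℚ),
    P = {x | ∀ i, ∑ j, (M i j : ℝ) * x j ≤ (β i : ℝ)}

theorem IsRationalPolyhedron.facetComplexity_spec {J : Type} [Fintype J] {P : Set (J → ℝ)}
    (hP : IsRationalPolyhedron P) : Fintype.card J ≤ facetComplexity P ∧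
      ∃ (N : ℕ) (M : Matrix (Fin N) J ℚ) (β : Fin N → ℚ),
        P = {x | ∀ i, ∑ j, (M i j : ℝ) * x j ≤ (β i : ℝ)} ∧
        ∀ i, ineqSize (M i) (β i) ≤ facetComplexity P := by
  obtain ⟨N, M, β, h⟩ := hP
  exact Nat.sInf_mem (s := {φ : ℕ | Fintype.card J ≤ φ ∧ ∃ (N : ℕ) (M : Matrix (Fin N) J ℚ)
    (β : Fin N → ℚ), P = {x | ∀ i, ∑ j, (M i j : ℝ) * x j ≤ (β i : ℝ)} ∧
      ∀ i, ineqSize (M i) (β i) ≤ φ}) ⟨Fintype.card J + ∑ i, ineqSize (M i) (β i),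
    Nat.le_add_right _ _, N, M, β, h, fun i => (Finset.single_le_sum (f := fun i => ineqSize (M i) (β i))
      (fun _ _ => Nat.zero_le _) (Finset.mem_univ i)).trans (Nat.le_add_left _ _)⟩

/-- A nonempty rational polyhedron meets the open ball of radius `schrijverRadius`. -/
theorem IsRationalPolyhedron.exists_norm_lt {J : Type} [Fintype J] [Nonempty J] {P : Set (J → ℝ)}
    (hP : IsRationalPolyhedron P) (hne : P.Nonempty) :
    ∃ y : EuclideanSpace ℝ J, y.ofLp ∈ P ∧ ‖y‖ < schrijverRadius P := by
  obtain ⟨hcard, N, M, β, hPe, hφ⟩ := hP.facetComplexity_spec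
  obtain ⟨x, hx⟩ := hne
  have hx' : ∀ i, ∑ j, (M i j : ℝ) * x j ≤ (β i : ℝ) := by rw [hPe] at hx; exact hx
  obtain ⟨y, hy, hyB⟩ := exists_small_point M β hφ ⟨x, hx'⟩
  refine ⟨WithLp.toLp 2 y, by rw [hPe]; exact hy, ?_⟩
  set φ := facetComplexity P
  have hJ : 0 < Fintype.card J := Fintype.card_pos
  have hle : ‖(WithLp.toLp 2 y : EuclideanSpace ℝ J)‖ ≤
      2 ^ (Fintype.card J * φ) * Real.sqrt (Fintype.card J) := by
    rw [EuclideanSpace.norm_eq]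
    refine Real.sqrt_le_iff.mpr ⟨by positivity, ?_⟩
    rw [mul_pow, Real.sq_sqrt (Nat.cast_nonneg _), mul_comm]
    refine (Finset.sum_le_card_nsmul _ _ ((2 ^ (Fintype.card J * φ)) ^ 2) fun j _ => ?_).trans_eq
      (by rw [Finset.card_univ, nsmul_eq_mul])
    have := hyB j
    rw [Real.norm_eq_abs]
    gcongr
  refine hle.trans_lt ?_
  rw [schrijverRadius]
  -- Strictness is needed, since a hyperplane at distance exactly the radius excludes only the open
  -- ball. It uses `φ > 0`, which follows from `card J ≤ φ`.
  have hlt : Fintype.card J * φ < 5 * Fintype.card J ^ 2 * φ := by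
    have : 0 < φ := hJ.trans_le hcard
    have h1 : 0 < Fintype.card J * φ := Nat.mul_pos hJ this
    nlinarith
  exact mul_lt_mul_of_pos_right (pow_lt_pow_right₀ one_lt_two hlt)
    (Real.sqrt_pos.mpr (by exact_mod_cast hJ))

theorem schrijverRadius_pos {J : Type} [Fintype J] [Nonempty J] (P : Set (J → ℝ)) :
    0 < schrijverRadius P :=
  mul_pos (by positivity) (Real.sqrt_pos.mpr (by exact_mod_cast Fintype.card_pos))

theorem LinSys.isRationalPolyhedron {I K J : Type} [Fintype I] [Fintype K] [Fintype J]
    (S : LinSys I K J) (hA : ∀ i j, ∃ q : ℚ, (q : ℝ) = S.A i j) (hb : ∀ i, ∃ q : ℚ, (q : ℝ) = S.b i)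
    (hC : ∀ k j, ∃ q : ℚ, (q : ℝ) = S.C k j) (hd : ∀ k, ∃ q : ℚ, (q : ℝ) = S.d k) :
    IsRationalPolyhedron {y | S.Feasible y} := by
  choose A hA using hA
  choose b hb using hb
  choose C hC using hC
  choose d hd using hd
  let e := Fintype.equivFin (I ⊕ I ⊕ K)
  refine ⟨_, Matrix.of fun i => Sum.elim A (Sum.elim (-A) C) (e.symm i),
    fun i => Sum.elim b (Sum.elim (-b) d) (e.symm i), ?_⟩
  ext y
  simp only [Set.mem_ofPred_eq, Matrix.of_apply, LinSys.Feasible]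
  rw [e.symm.forall_congr_left]
  simp only [Equiv.symm_symm, Equiv.symm_apply_apply, Sum.forall, Sum.elim_inl, Sum.elim_inr,
    Pi.neg_apply, Rat.cast_neg, hA, hb, hC, hd, neg_mul, Finset.sum_neg_distrib, neg_le_neg_iff]
  rw [← and_assoc, ← forall_and, funext_iff]
  simp only [← le_antisymm_iff]
  rfl

end Radius

end LFG

namespace LFG

/-! ## Correctness and finiteness of the LFG algorithm -/

section Main

variable {m l n : ℕ}

namespace Input

theorem dcSys_A_mulVec (D : Input m l n) (y : Fin n ⊕ Unit → ℝ) (i : Fin m) :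
    (D.dcSys.A *ᵥ y) i = (D.toSys.A *ᵥ (y ∘ Sum.inl)) i - D.toSys.b i * y (.inr ()) := by
  simp [dcSys, LinSys.strengthen, LinSys.parameterize, LinSys.relax, Matrix.mulVec, dotProduct,
    sub_eq_add_neg]

theorem dcSys_C_mulVec_inl (D : Input m l n) (y : Fin n ⊕ Unit → ℝ) (k : Fin l) :
    (D.dcSys.C *ᵥ y) (.inl k) =
      (D.toSys.C *ᵥ (y ∘ Sum.inl)) k - (D.toSys.d k + D.nu / 2) * y (.inr ()) := by
  simp [dcSys, LinSys.strengthen, LinSys.parameterize, LinSys.relax, Matrix.mulVec, dotProduct]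
  ring

theorem dcSys_C_mulVec_inr (D : Input m l n) (y : Fin n ⊕ Unit → ℝ) :
    (D.dcSys.C *ᵥ y) (.inr ()) = -y (.inr ()) := by
  simp [dcSys, LinSys.strengthen, LinSys.parameterize, LinSys.relax, Matrix.mulVec, dotProduct]

theorem dcSys_b (D : Input m l n) : D.dcSys.b = 0 := rfl

theorem dcSys_d_inl (D : Input m l n) (k : Fin l) : D.dcSys.d (.inl k) = -1 := zero_sub 1

theorem dcSys_d_inr (D : Input m l n) : D.dcSys.d (.inr ()) = -2 := by
  change (-1 : ℝ) - 1 = -2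
  norm_num

theorem nu_le_one (D : Input m l n) : D.nu ≤ 1 :=
  inv_le_one_of_one_le₀ (one_le_pow₀ one_le_two)

/-- Even if `c_k = 0`, the coefficient `-(d_k + ν/2)` of `t` is nonzero, because `d_k` is an integer
and `0 < ν/2 ≤ 1/2`. -/
theorem dcSys_row_ne_zero (D : Input m l n) (k : Fin l ⊕ Unit) : D.dcSys.row k ≠ 0 := by
  intro h
  have h0 := congrArg (fun v : EuclideanSpace ℝ (Fin n ⊕ Unit) => v.ofLp (.inr ())) h
  cases k with
  | inl k =>
    have h1 : -((D.d k : ℝ) + D.nu / 2) = 0 := h0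
    have h2 : (0 : ℝ) < (-2 * D.d k : ℤ) := by push_cast; linarith [D.nu_pos]
    have h3 : ((-2 * D.d k : ℤ) : ℝ) ≤ (1 : ℤ) := by push_cast; linarith [D.nu_le_one]
    have h4 : 0 < -2 * D.d k := by exact_mod_cast h2
    have h5 : -2 * D.d k ≤ 1 := by exact_mod_cast h3
    omega
  | inr u =>
    have h1 : (-1 : ℝ) = 0 := h0
    norm_num at h1

theorem dcSys_isRationalPolyhedron (D : Input m l n) :
    IsRationalPolyhedron {y | D.dcSys.Feasible y} := by
  have hν : ∃ q : ℚ, (q : ℝ) = D.nu := ⟨(2 ^ (2 * D.bitLength))⁻¹, by rw [nu]; push_cast; rfl⟩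
  obtain ⟨ν, hν⟩ := hν
  refine LinSys.isRationalPolyhedron _ ?_ ?_ ?_ ?_
  · rintro i (j | j)
    · exact ⟨D.A i j, by push_cast; rfl⟩
    · exact ⟨-D.b i, by push_cast; rfl⟩
  · exact fun i => ⟨0, by push_cast; rfl⟩
  · rintro (k | k) (j | j)
    · exact ⟨D.C k j, by push_cast; rfl⟩
    · exact ⟨-(D.d k + ν / 2), by push_cast; rw [hν]; rfl⟩
    · exact ⟨0, by push_cast; rfl⟩
    · exact ⟨-1, by push_cast; rfl⟩
  · rintro (k | k)
    · exact ⟨-1, by rw [dcSys_d_inl]; norm_num⟩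
    · exact ⟨-2, by rw [dcSys_d_inr]; norm_num⟩

/-- A solution of the original system scales to a solution of the strengthened one. -/
theorem exists_dcSys_feasible (D : Input m l n) {x : Fin n → ℝ} (hx : D.toSys.Feasible x) :
    ∃ y, D.dcSys.Feasible y := by
  have hν := D.nu_pos
  have ht : 2 ≤ 2 / D.nu := (le_div_iff₀ hν).mpr (by linarith [D.nu_le_one])
  have ht0 : 0 < 2 / D.nu := by positivity
  have hcomp : (Sum.elim ((2 / D.nu) • x) fun _ => 2 / D.nu : Fin n ⊕ Unit → ℝ) ∘ Sum.inl =
      (2 / D.nu) • x := rfl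
  -- With `t = 2/ν` the relaxation `ν/2` becomes a slack of exactly 1, and `ν ≤ 1` gives `t ≥ 2`.
  refine ⟨Sum.elim ((2 / D.nu) • x) fun _ => 2 / D.nu, funext fun i => ?_, ?_⟩
  · rw [dcSys_A_mulVec, hcomp, Matrix.mulVec_smul, hx.1, dcSys_b, Sum.elim_inr, Pi.smul_apply,
      smul_eq_mul, Pi.zero_apply]
    ring
  · rintro (k | k)
    · rw [dcSys_C_mulVec_inl, hcomp, Matrix.mulVec_smul, dcSys_d_inl, Sum.elim_inr, Pi.smul_apply,
        smul_eq_mul]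
      have h1 : 2 / D.nu * (D.toSys.C *ᵥ x) k ≤ 2 / D.nu * D.toSys.d k := by
        gcongr
        exact hx.2 k
      have h2 : D.nu / 2 * (2 / D.nu) = 1 := by field_simp
      nlinarith
    · rw [dcSys_C_mulVec_inr, dcSys_d_inr, Sum.elim_inr]
      linarith

/-- An approximate solution found by D&C yields a point that can be rounded. -/
theorem isApprox_of_outcomeOK (D : Input m l n) {z y : EuclideanSpace ℝ (Fin n ⊕ Unit)} {r : ℝ}
    (h : OutcomeOK D.dcSys 1 z r (.solution y)) :
    D.IsApprox fun j => y.ofLp (.inl j) / y.ofLp (.inr ()) := by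
  obtain ⟨hA, hC⟩ := h
  set t := y.ofLp (.inr ()) with ht
  -- The error `ε = 1` turns `-t ≤ -2` into `-t < -1`, so division by `t` is legitimate.
  have ht0 : 0 < t := by
    have := hC (.inr ())
    rw [dcSys_C_mulVec_inr, dcSys_d_inr] at this
    linarith
  have hx : (fun j => y.ofLp (.inl j) / t) = t⁻¹ • (y.ofLp ∘ Sum.inl) := by
    funext j
    simp [div_eq_inv_mul]
  rw [hx]
  refine ⟨funext fun i => ?_, fun k => ?_⟩
  · have := congrFun hA i
    rw [dcSys_A_mulVec, dcSys_b, Pi.zero_apply, ← ht] at this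
    rw [Matrix.mulVec_smul, Pi.smul_apply, smul_eq_mul, inv_mul_eq_iff_eq_mul₀ ht0.ne']
    linarith
  · have := hC (.inl k)
    rw [dcSys_C_mulVec_inl, dcSys_d_inl, ← ht] at this
    rw [Matrix.mulVec_smul, Pi.smul_apply, smul_eq_mul, inv_mul_lt_iff₀ ht0]
    nlinarith [mul_pos D.nu_pos ht0]

/-- A hyperplane returned by D&C certifies infeasibility. -/
theorem infeasible_of_separates (D : Input m l n) {h : EuclideanSpace ℝ (Fin n ⊕ Unit)} {δ : ℝ}
    (hs : Separates D.dcSys 0 D.radius h δ) : ¬ ∃ x, D.toSys.Feasible x := by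
  rintro ⟨x, hx⟩
  obtain ⟨y, hy, hyr⟩ := D.dcSys_isRationalPolyhedron.exists_norm_lt (D.exists_dcSys_feasible hx)
  obtain ⟨hne, hval, hdist⟩ := hs
  have h1 := hval y hy
  rw [inner_zero_right] at hdist
  have h2 := neg_le_of_abs_le (abs_real_inner_le_norm h y)
  have h3 : ‖h‖ * ‖y‖ < ‖h‖ * D.radius := mul_lt_mul_of_pos_left hyr (norm_pos_iff.mpr hne)
  linarith

/-- The base case threshold of D&C on the strengthened system. -/
noncomputable def threshold (D : Input m l n) : ℝ := 1 / (2 * D.dcSys.normCmax)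

theorem threshold_pos (D : Input m l n) : 0 < D.threshold := by
  have := (norm_pos_iff.mpr (D.dcSys_row_ne_zero (.inr ()))).trans_le (D.dcSys.norm_row_le _)
  rw [threshold]
  positivity

end Input

/-! ### Invariant and cost of the whole run -/

/-- The invariant of a run of the LFG algorithm. -/
def Inv (D : Input m l n) : State n → Prop
  | .start => True
  | .dc s => DCInv D.dcSys 1 0 D.radius s
  | .rounding x => D.IsApprox x
  | .feasible x => D.toSys.Feasible x
  | .infeasible => ¬ ∃ x, D.toSys.Feasible x

/-- An upper bound for the number of steps of the LFG algorithm from a given configuration. -/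
noncomputable def cost (D : Input m l n) : State n → ℕ
  | .start => stateCost D.threshold
      (.call (0 : EuclideanSpace ℝ (Fin n ⊕ Unit)) D.radius []) + l + 3
  | .dc s => stateCost D.threshold s + l + 2
  | .rounding x => l - (D.active x).ncard + 1
  | .feasible _ => 0
  | .infeasible => 0

theorem Inv.step {D : Input m l n} {s s' : State n} (hs : Inv D s) (h : Step D s s') :
    Inv D s' := by
  cases h with
  | init => exact ⟨schrijverRadius_pos _, rfl, rfl⟩
  | dc s s' h => exact DCInv.step D.dcSys_row_ne_zero hs h
  | found y =>
    obtain ⟨z, r, -, -, ho⟩ := hs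
    exact D.isApprox_of_outcomeOK ho
  | separated h δ =>
    obtain ⟨z, r, -, ⟨rfl, rfl⟩, ho⟩ := hs
    exact D.infeasible_of_separates ho
  | failed =>
    obtain ⟨z, r, -, -, ho⟩ := hs
    rintro ⟨x, hx⟩
    obtain ⟨y, hy⟩ := D.exists_dcSys_feasible hx
    exact ho y hy
  | move x w k j hk hspan hwA hwL hwk hj hwj hmin =>
    exact (Input.IsApprox.move hs hwA hwL hj hwj hmin).1
  | finish x y I' L' hspan hL hindep hI hmax hyA hyL =>
    exact Input.IsApprox.feasible_of_finish hs hspan hL hindep hI hmax hyA hyL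

theorem Inv.cost_lt {D : Input m l n} {s s' : State n} (hs : Inv D s) (h : Step D s s') :
    cost D s' < cost D s := by
  cases h with
  | init => simp only [cost]; omega
  | dc s s' h =>
    have := h.stateCost_lt D.threshold_pos
    simp only [cost]
    change stateCost D.threshold s' < stateCost D.threshold s at this
    omega
  | found y => simp only [cost]; omega
  | separated h δ => simp only [cost]; omega
  | failed => simp only [cost]; omega
  | move x w k j hk hspan hwA hwL hwk hj hwj hmin =>
    have h1 := Set.ncard_lt_ncard (Input.IsApprox.move hs hwA hwL hj hwj hmin).2 (Set.toFinite _)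
    have h2 : ∀ s : Set (Fin l), s.ncard ≤ l := fun s => by
      simpa using Set.ncard_le_card s
    have h3 := h2 (D.active
      (x + ((D.toSys.d j - (D.toSys.C *ᵥ x) j) / (D.toSys.C *ᵥ w) j) • w))
    simp only [cost]
    omega
  | finish x y I' L' hspan hL hindep hI hmax hyA hyL => simp only [cost]; omega

theorem Inv.progress {D : Input m l n} {s : State n} (hs : Inv D s) (hstuck : ¬ ∃ s', Step D s s') :
    (∃ x, s = .feasible x) ∨ s = .infeasible := by
  match s, hs with
  | .start, _ => exact absurd ⟨_, .init⟩ hstuck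
  | .dc s, hs =>
    refine absurd ?_ hstuck
    -- The homogenized equations are solved by 0, so projections exist even when `A x = b` is
    -- inconsistent.
    rcases DCInv.progress ⟨0, Matrix.mulVec_zero _⟩ hs with ⟨s', h⟩ | ⟨o, rfl⟩
    · exact ⟨_, .dc s s' h⟩
    · cases o with
      | solution y => exact ⟨_, .found y⟩
      | hyperplane h δ => exact ⟨_, .separated h δ⟩
      | failure => exact ⟨_, .failed⟩
  | .rounding x, hs =>
    refine absurd ?_ hstuck
    by_cases h : ∀ k, k ∉ D.active x → D.toSys.C k ∈ D.rowSpan Set.univ (D.active x)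
    · exact D.exists_finish h
    · push Not at h
      obtain ⟨k, hk, hspan⟩ := h
      exact D.exists_move hk hspan
  | .feasible x, _ => exact .inl ⟨x, rfl⟩
  | .infeasible, _ => exact .inr rfl

theorem StepsTo.inv {D : Input m l n} {N : ℕ} {s : State n} (h : StepsTo D N s) :
    Inv D s ∧ N + cost D s ≤ cost D .start := by
  induction h with
  | zero => exact ⟨trivial, by omega⟩
  | succ N s s' _ hs ih =>
    have := ih.1.cost_lt hs
    exact ⟨ih.1.step hs, by omega⟩

end Main

end LFG

theorem mainTheorem5 (m l n : ℕ) (D : LFG.Input m l n) :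
    (∃ B : ℕ, ∀ (N : ℕ) (s : LFG.State n), LFG.StepsTo D N s → N ≤ B) ∧
    (∀ (N : ℕ) (s : LFG.State n), LFG.StepsTo D N s → (¬ ∃ s', LFG.Step D s s') →
      (∃ x, s = .feasible x ∧ D.toSys.Feasible x) ∨
      (s = .infeasible ∧ ¬ ∃ x, D.toSys.Feasible x)) := by
  refine ⟨⟨LFG.cost D .start, fun N s h => (Nat.le_add_right _ _).trans h.inv.2⟩,
    fun N s h hstuck => ?_⟩
  rcases h.inv.1.progress hstuck with ⟨x, rfl⟩ | rfl
  · exact .inl ⟨x, rfl, h.inv.1⟩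
  · exact .inr ⟨rfl, h.inv.1⟩
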